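/- Let $s\ge 2$ be an integer and let $\mathbb{Z}_s=\{\sum_{j\ge 0}x_js^j : 0\le x_j\le s-1\}$ be the space of $s$-adic integers, with the product topology on digit sequences, in which the nonnegative integers embed through their base-$s$ expansions. Let $\mathcal V=\{(n,x) : n\in\mathbb{Z}_{\ge 0},\ 0\le x<s^n\}$ and let $H=\ell^2(\mathcal V)$ with canonical basis $\{E_{(n,x)}\}$. The Serre shift $W\in B(H)$ and, for $f\in C(\mathbb{Z}_s)$, the operator $M_f\in B(H)$ are given by $$WE_{(n,x)}=\frac1{\sqrt s}\sum_{j=0}^{s-1}E_{(n+1,\,x+js^n)},\qquad M_fE_{(n,x)}=f(x)E_{(n,x)},$$ and $A_W=C^*(W,M_f\mid f\in C(\mathbb{Z}_s))\subseteq B(H)$. For $\theta\in\mathbb{R}$ let $\mathcal U_\theta E_{(n,x)}=e^{2\pi i n\theta}E_{(n,x)}$, let $I_W$ be the set of compact operators $a$ on $H$ with $\mathcal U_\theta a\,\mathcal U_\theta^{*}=a$ for all $\theta$, and let $\mathcal I_W=C^*(aW^n\mid a\in I_W,\ n\ge 0)$. Let $\mathcal T\subseteq B(\ell^2(\mathbb{Z}_{\ge0}))$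 be the Toeplitz algebra, i.e. the $C^*$-algebra generated by the unilateral shift $S$. Let $\mathcal T\otimes C(\mathbb{Z}_s)$ be the spatial $C^*$-tensor product: for unital faithful $*$-representations $\pi$ of $\mathcal T$ on a Hilbert space $E$ and $\sigma$ of $C(\mathbb{Z}_s)$ on a Hilbert space $F$, it is the $C^*$-algebra of operators on the Hilbert space tensor product of $E$ and $F$ generated by all $\pi(a)\otimes\sigma(f)$, where this operator is written $a\otimes f$. (Since $C(\mathbb{Z}_s)$ is commutative, it is the only $C^*$-tensor product.) Then, for any choice of $\pi$ and $\sigma$, one has $\mathcal I_W=\mathcal K$, the algebra of all compact operators on $H$; moreover $\mathcal K\subseteq A_W$, and there is a short exact sequence of $C^*$-algebras $$0\longrightarrow\mathcal K\longrightarrow A_W\stackrel{q}{\longrightarrow}\mathcal T\otimes C(\mathbb{Z}_s)\longrightarrow 0,$$ in which the first map is the inclusion and $q$ is a unital $*$-homomorphism with $q(W)=S\otimes 1$ and $q(M_f)=1\otimes f$ for all $f\in C(\mathbb{Z}_s)$. -/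

import Mathlib

open scoped TensorProduct InnerProductSpace

noncomputable section

namespace SerreShift

/-! ### The `s`-adic integers and the tree of balls -/

/-- The space of `s`-adic integers: formal series `∑ x_j s^j` with digits `0 ≤ x_j < s`,
carrying the product topology. (The ring operations play no role below.) -/
abbrev SAdicInt (s : ℕ) : Type := ℕ → Fin s

/-- The `s`-adic expansion of a natural number, i.e. the embedding of the nonnegative integers
into the `s`-adic integers. -/
def ofNat (s : ℕ) [NeZero s] (x : ℕ) : SAdicInt s := fun j => Fin.ofNat s (x / s ^ j)

/-- The set of balls in the `s`-adic integers: the pair `(n, x)` with `0 ≤ x < s ^ n` stands for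
the ball of radius `s ^ (-n)` around `x`. -/
abbrev Vertex (s : ℕ) : Type := Σ n : ℕ, Fin (s ^ n)

/-- The ball `(n + 1, x + j s ^ n)`, for a ball `(n, x)` and a digit `j`. -/
def child {s : ℕ} (v : Vertex s) (j : Fin s) : Vertex s :=
  ⟨v.1 + 1, ⟨v.2 + j * s ^ v.1, by
    have h1 := v.2.isLt
    have h2 := Nat.mul_le_mul_right (s ^ v.1) (Nat.succ_le_of_lt j.isLt)
    rw [Nat.succ_mul] at h2
    rw [pow_succ, mul_comm (s ^ v.1)]
    omega⟩⟩

theorem child_injective {s : ℕ} {v w : Vertex s} {i j : Fin s} (h : child v i = child w j) :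
    v = w ∧ i = j := by
  obtain ⟨n, x⟩ := v
  obtain ⟨m, y⟩ := w
  have h1 : n = m := by
    have := congrArg Sigma.fst h
    simpa [child] using this
  subst h1
  have h2 : (x : ℕ) + i * s ^ n = y + j * s ^ n := by
    simpa [child] using h
  have hx := x.isLt
  have hy := y.isLt
  have hpos : 0 < s ^ n := by omega
  have hxy : (x : ℕ) = y := by
    have := congrArg (· % s ^ n) h2
    simpa [Nat.mod_eq_of_lt hx, Nat.mod_eq_of_lt hy] using this
  have hij : (i : ℕ) = j := by
    rw [hxy] at h2
    exact Nat.eq_of_mul_eq_mul_right hpos (Nat.add_left_cancel h2)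
  exact ⟨by rw [Fin.ext hxy], Fin.ext hij⟩

/-! ### Hilbert spaces and operators on them -/

/-- The complex Hilbert space `ℓ²(ι)`. -/
abbrev L2 (ι : Type*) : Type _ := lp (fun _ : ι => ℂ) 2

/-- The algebra `B(E)` of bounded operators. -/
abbrev Op (E : Type*) [NormedAddCommGroup E] [InnerProductSpace ℂ E] : Type _ := E →L[ℂ] E

/-- The canonical basis vector `E_i` of `ℓ²(ι)`. -/
def basisVec {ι : Type*} [DecidableEq ι] (i : ι) : L2 ι := lp.single 2 i (1 : ℂ)

theorem inner_basisVec {ι : Type*} [DecidableEq ι] (i j : ι) :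
    ⟪basisVec i, basisVec j⟫_ℂ = if i = j then 1 else 0 := by
  unfold basisVec
  rw [lp.inner_single_left]
  by_cases h : i = j
  · subst h
    simp
  · simp [h]

/-- The diagonal operator `E_i ↦ F i • E_i` on `ℓ²(ι)`, for a function `F` bounded by `C`. -/
def diagOp {ι : Type*} (F : ι → ℂ) {C : ℝ} (hC : 0 ≤ C) (hF : ∀ i, ‖F i‖ ≤ C) : Op (L2 ι) :=
  lp.mapCLM 2 (fun i => F i • ContinuousLinearMap.id ℂ ℂ) hC fun i => by
    simpa [norm_smul] using hF i

/-- The isometry of `ℓ²(ι)` that sends the canonical basis to a given orthonormal family. -/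
def isometryOp {ι : Type*} {w : ι → L2 ι} (hw : Orthonormal ℂ w) : Op (L2 ι) :=
  hw.orthogonalFamily.linearIsometry.toContinuousLinearMap

theorem isometryOp_basisVec {ι : Type*} [DecidableEq ι] {w : ι → L2 ι} (hw : Orthonormal ℂ w)
    (i : ι) : isometryOp hw (basisVec i) = w i := by
  unfold isometryOp basisVec
  simp [OrthogonalFamily.linearIsometry_apply_single]

/-! ### The Serre shift and its algebra -/

/-- The vector `s^(-1/2) ∑_{j < s} E_{(n + 1, x + j s ^ n)}`. -/
def serreVec (s : ℕ) (v : Vertex s) : L2 (Vertex s) :=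
  (((√(s : ℝ))⁻¹ : ℝ) : ℂ) • ∑ j : Fin s, basisVec (child v j)

theorem orthonormal_serreVec (s : ℕ) [NeZero s] : Orthonormal ℂ (serreVec s) := by
  have hs : (0 : ℝ) < s := by exact_mod_cast Nat.pos_of_ne_zero (NeZero.ne s)
  rw [orthonormal_iff_ite]
  intro v w
  have key : ∀ i j : Fin s, (if child v i = child w j then (1 : ℂ) else 0)
      = if v = w then (if i = j then 1 else 0) else 0 := by
    intro i j
    by_cases h : v = w
    · subst h
      by_cases hij : i = j
      · simp [hij]
      · rw [if_neg fun e => hij (child_injective e).2]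
        simp [hij]
    · rw [if_neg fun e => h (child_injective e).1, if_neg h]
  unfold serreVec
  rw [inner_smul_left, inner_smul_right, sum_inner]
  simp_rw [inner_sum, inner_basisVec, key]
  by_cases h : v = w
  · subst h
    simp only [if_true, Finset.sum_ite_eq, Finset.mem_univ, Finset.sum_const, Finset.card_univ,
      Fintype.card_fin, nsmul_eq_mul, mul_one, Complex.conj_ofReal]
    have : (√(s : ℝ))⁻¹ * ((√(s : ℝ))⁻¹ * s) = 1 := by
      rw [← mul_assoc, ← mul_inv, Real.mul_self_sqrt hs.le, inv_mul_cancel₀ hs.ne']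
    exact_mod_cast this
  · simp [h]

/-- The Serre shift `W E_{(n,x)} = s^(-1/2) ∑_{j < s} E_{(n + 1, x + j s ^ n)}`. -/
def serreShift (s : ℕ) [NeZero s] : Op (L2 (Vertex s)) := isometryOp (orthonormal_serreVec s)

theorem serreShift_basisVec (s : ℕ) [NeZero s] (v : Vertex s) :
    serreShift s (basisVec v) =
      (((√(s : ℝ))⁻¹ : ℝ) : ℂ) • ∑ j : Fin s, basisVec (child v j) :=
  isometryOp_basisVec _ v

/-- The diagonal operator `M_f E_{(n,x)} = f(x) E_{(n,x)}`, for a continuous function `f` on the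
`s`-adic integers. -/
def multOp {s : ℕ} [NeZero s] (f : C(SAdicInt s, ℂ)) : Op (L2 (Vertex s)) :=
  diagOp (fun v => f (ofNat s v.2)) (norm_nonneg f) fun v => f.norm_coe_le_norm (ofNat s v.2)

/-- The shift algebra `A_W`: the C*-algebra generated by the Serre shift `W` and all `M_f`. -/
def serreAlgebra (s : ℕ) [NeZero s] : StarSubalgebra ℂ (Op (L2 (Vertex s))) :=
  (StarAlgebra.adjoin ℂ (insert (serreShift s) (Set.range multOp))).topologicalClosure

/-- `W` as an element of `A_W`. -/
def genW (s : ℕ) [NeZero s] : serreAlgebra s :=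
  ⟨serreShift s, StarSubalgebra.le_topologicalClosure _
    (StarAlgebra.subset_adjoin ℂ _ (Set.mem_insert _ _))⟩

/-- `M_f` as an element of `A_W`. -/
def genM {s : ℕ} [NeZero s] (f : C(SAdicInt s, ℂ)) : serreAlgebra s :=
  ⟨multOp f, StarSubalgebra.le_topologicalClosure _
    (StarAlgebra.subset_adjoin ℂ _ (Set.mem_insert_of_mem _ (Set.mem_range_self f)))⟩

/-! ### The gauge action and the ideal `𝓘_W` -/

/-- The unitary `E_{(n,x)} ↦ e^{2πinθ} E_{(n,x)}`. -/
def gaugeUnitary (s : ℕ) (θ : ℝ) : Op (L2 (Vertex s)) :=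
  diagOp (fun v => Complex.exp ((2 * Real.pi * v.1 * θ : ℝ) * Complex.I)) zero_le_one fun v => by
    rw [Complex.norm_exp_ofReal_mul_I]

/-- The gauge invariant compact operators on `ℓ²` of the tree. -/
def gaugeInvCompact (s : ℕ) : Set (Op (L2 (Vertex s))) :=
  {a | IsCompactOperator a ∧ ∀ θ : ℝ, gaugeUnitary s θ * a * star (gaugeUnitary s θ) = a}

/-- The C*-algebra `𝓘_W` generated by all `a W ^ n` with `a` compact and gauge invariant
and `n ≥ 0`. -/
def serreIdeal (s : ℕ) [NeZero s] : NonUnitalStarSubalgebra ℂ (Op (L2 (Vertex s))) :=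
  (NonUnitalStarAlgebra.adjoin ℂ
    {T | ∃ a ∈ gaugeInvCompact s, ∃ n : ℕ, T = a * serreShift s ^ n}).topologicalClosure

/-! ### The Toeplitz algebra -/

theorem orthonormal_succ : Orthonormal ℂ (fun n : ℕ => (basisVec (n + 1) : L2 ℕ)) := by
  rw [orthonormal_iff_ite]
  intro i j
  rw [inner_basisVec]
  simp

/-- The unilateral shift `E_n ↦ E_{n+1}` on `ℓ²(ℕ)`. -/
def unilateralShift : Op (L2 ℕ) := isometryOp orthonormal_succ

/-- The Toeplitz algebra: the C*-algebra generated by the unilateral shift. -/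
def toeplitzAlgebra : StarSubalgebra ℂ (Op (L2 ℕ)) := StarAlgebra.elemental ℂ unilateralShift

/-- The unilateral shift as an element of the Toeplitz algebra. -/
def genS : toeplitzAlgebra := ⟨unilateralShift, StarAlgebra.elemental.self_mem ℂ _⟩

/-! ### The spatial tensor product of C*-algebras -/

section Tensor

variable {E F : Type*} [NormedAddCommGroup E] [InnerProductSpace ℂ E]
  [NormedAddCommGroup F] [InnerProductSpace ℂ F]

/-- The Hilbert space tensor product. -/
abbrev HilbertTensor (E F : Type*) [NormedAddCommGroup E] [InnerProductSpace ℂ E]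
    [NormedAddCommGroup F] [InnerProductSpace ℂ F] : Type _ :=
  UniformSpace.Completion (E ⊗[ℂ] F)

/-- The operator `a ⊗ b` on the Hilbert space tensor product,
with `(a ⊗ b) (x ⊗ y) = a x ⊗ b y`. -/
def opTensor (a : Op E) (b : Op F) : Op (HilbertTensor E F) :=
  (TensorProduct.mapL a b).completion

theorem opTensor_tmul (a : Op E) (b : Op F) (x : E) (y : F) :
    opTensor a b ((x ⊗ₜ[ℂ] y : E ⊗[ℂ] F) : HilbertTensor E F)
      = ((a x ⊗ₜ[ℂ] b y : E ⊗[ℂ] F) : HilbertTensor E F) := by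
  simp [opTensor]

variable [CompleteSpace E] [CompleteSpace F] {A B : Type*} [Semiring A] [Algebra ℂ A] [Star A]
  [Semiring B] [Algebra ℂ B] [Star B]

/-- The spatial tensor product of two unital C*-algebras, computed in representations `π` and `σ`:
the C*-algebra generated by the operators `π a ⊗ σ b`. For faithful `π` and `σ` this is the
spatial C*-tensor product. -/
def spatialTensor (π : A →⋆ₐ[ℂ] Op E) (σ : B →⋆ₐ[ℂ] Op F) :
    StarSubalgebra ℂ (Op (HilbertTensor E F)) :=
  (StarAlgebra.adjoin ℂ {T | ∃ a b, T = opTensor (π a) (σ b)}).topologicalClosure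

/-- The elementary tensor `a ⊗ b` as an element of the spatial tensor product. -/
def elemTensor (π : A →⋆ₐ[ℂ] Op E) (σ : B →⋆ₐ[ℂ] Op F) (a : A) (b : B) : spatialTensor π σ :=
  ⟨opTensor (π a) (σ b), StarSubalgebra.le_topologicalClosure _
    (StarAlgebra.subset_adjoin ℂ _ ⟨a, b, rfl⟩)⟩

end Tensor

end SerreShift

end

/-! The Serre shift `W` is an isometry that raises levels, so it has no unitary part. By the Wold
decomposition `ℓ²` of the tree is a Hilbert sum of copies of `ℓ²(ℕ)` on which `W` acts as the
unilateral shift, and there is a representation `ρ` of the Toeplitz algebra with `ρ S = W`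
(`exists_toeplitz_rep`, `exists_serre_rep`). For a step function `f` the commutator of `W` and `M_f`
vanishes on all but finitely many basis vectors, so `ρ a` and `M_f` commute modulo compacts for all
`a` and `f` (`commutator_rep_mult`).

Hence the sums `∑ ρ (b w) M_{1_w}` over the cylinders `w` of a common depth form, modulo compacts, a
dense star subalgebra of `A_W`, just as the sums `∑ b w ⊗ 1_w` do in the tensor product. In both
cases the norm is `max ‖b w‖`, on the tree after dividing by the compacts. The tensor sums are block
diagonal. On the tree, a compact perturbation makes the sum block diagonal, which bounds the
quotient norm above (`exists_compact_norm_sub_le`). For the lower bound, every ball contains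
arbitrarily deep wandering vectors of `W`; such a vector generates a copy of `ℓ²(ℕ)` on which the
sum acts as `b w` and a compact operator is negligible (`norm_coeff_le`). `exists_quotient_of_graph`
turns this equality of norms into the map `q`.

The compacts lie in `A_W` because the commutator of `W` with the indicator of one first digit is a
multiple of a single matrix unit (`commutator_cyl_one`), which yields all the others. They make up
`𝓘_W` because matrix units inside one level, multiplied by powers of `W`, give every matrix unit up
to adjoints (`matUnit_mem_serreIdeal`). -/

noncomputable section

namespace SerreShift

open Filter Topology InnerProductSpace

/-! ### Compact operators on `ℓ²` -/

section Compact

variable {ι : Type*} [DecidableEq ι]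

theorem inner_basisVec_left (i : ι) (x : L2 ι) : ⟪basisVec i, x⟫_ℂ = x i := by
  unfold basisVec
  rw [lp.inner_single_left]
  simp

theorem norm_basisVec (i : ι) : ‖(basisVec i : L2 ι)‖ = 1 := by
  have h := inner_basisVec i i
  rw [inner_self_eq_norm_sq_to_K, if_pos rfl] at h
  have h2 : ‖(basisVec i : L2 ι)‖ ^ 2 = 1 := by
    apply Complex.ofReal_injective
    push_cast
    exact h
  exact (pow_eq_one_iff_of_nonneg (norm_nonneg _) two_ne_zero).1 h2

theorem basisVec_apply (i j : ι) : (basisVec i : L2 ι) j = if j = i then 1 else 0 := by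
  rw [← inner_basisVec_left, inner_basisVec]

theorem hasSum_basisVec (x : L2 ι) : HasSum (fun i => x i • (basisVec i : L2 ι)) x := by
  have h := lp.hasSum_single (p := 2) (by simp) x
  refine h.congr_fun ?_
  intro i
  unfold basisVec
  rw [← lp.single_smul]
  simp

/-- Two operators that agree on the canonical basis are equal. -/
theorem ext_basisVec {G : Type*} [NormedAddCommGroup G] [NormedSpace ℂ G]
    {f g : L2 ι →L[ℂ] G} (h : ∀ i, f (basisVec i) = g (basisVec i)) : f = g := by
  ext x
  have h1 := (hasSum_basisVec x).mapL f
  have h2 := (hasSum_basisVec x).mapL g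
  simp only [map_smul, h] at h1 h2
  exact h1.unique h2

/-- The matrix unit `|E_i⟩⟨E_j|`. -/
def matUnit (i j : ι) : Op (L2 ι) := rankOne ℂ (basisVec i) (basisVec j)

theorem isCompactOperator_rankOne {G G' : Type*} [NormedAddCommGroup G] [InnerProductSpace ℂ G]
    [NormedAddCommGroup G'] [InnerProductSpace ℂ G'] (x : G) (y : G') :
    IsCompactOperator (rankOne ℂ x y) := by
  rw [rankOne_def']
  exact (isCompactOperator_of_locallyCompactSpace_rng (M₂ := ℂ)
    (ContinuousLinearMap.toSpanSingleton ℂ x)).comp_clm (innerSL ℂ y)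

theorem isCompactOperator_matUnit (i j : ι) : IsCompactOperator (matUnit i j : Op (L2 ι)) :=
  isCompactOperator_rankOne _ _

theorem star_matUnit (i j : ι) : star (matUnit i j) = matUnit j i :=
  adjoint_rankOne _ _

/-- The projection onto the span of finitely many canonical basis vectors. -/
def finProj (s : Finset ι) : Op (L2 ι) := ∑ i ∈ s, matUnit i i

theorem finProj_apply (s : Finset ι) (x : L2 ι) :
    finProj s x = ∑ i ∈ s, x i • (basisVec i : L2 ι) := by
  simp [finProj, matUnit, inner_basisVec_left]

theorem tendsto_finProj (x : L2 ι) : Tendsto (fun s : Finset ι => finProj s x) atTop (𝓝 x) := by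
  simp only [finProj_apply]
  exact hasSum_basisVec x

theorem norm_finProj_apply_le (s : Finset ι) (x : L2 ι) : ‖finProj s x‖ ≤ ‖x‖ := by
  have h : ⟪finProj s x, finProj s x⟫_ℂ = ⟪finProj s x, x⟫_ℂ := by
    simp only [finProj_apply, sum_inner, inner_smul_left, inner_basisVec_left]
    refine Finset.sum_congr rfl fun i hi => ?_
    have : (∑ j ∈ s, x j • (basisVec j : L2 ι)) i = x i := by
      rw [← inner_basisVec_left, inner_sum]
      simp [inner_smul_right, inner_basisVec, hi]
    rw [this]
  have h1 : ‖finProj s x‖ ^ 2 ≤ ‖finProj s x‖ * ‖x‖ := by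
    have := norm_inner_le_norm (𝕜 := ℂ) (finProj s x) x
    rw [← h, inner_self_eq_norm_sq_to_K] at this
    simpa using this
  by_contra hlt
  push Not at hlt
  have h0 : 0 < ‖finProj s x‖ := (norm_nonneg _).trans_lt hlt
  nlinarith

/-- A compact operator is approximated by its finite-rank compressions. -/
theorem exists_finProj_mul_sub_lt {k : Op (L2 ι)} (hk : IsCompactOperator k) {ε : ℝ}
    (hε : 0 < ε) : ∃ s : Finset ι, ‖k - finProj s * k‖ < ε := by
  obtain ⟨Q, hQ, hkQ⟩ := IsCompactOperator.image_closedBall_subset_compact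
    (f := (k : L2 ι →ₗ[ℂ] L2 ι)) hk 1
  -- The error at a unit vector `x` splits, through a net point `y` near `k x`, into three terms
  -- below `ε / 8`. The bound `ε / 2` leaves room for the supremum over `x`.
  obtain ⟨t, htf, ht⟩ := Metric.totallyBounded_iff.1 hQ.totallyBounded (ε / 8) (by positivity)
  have hev : ∀ᶠ s : Finset ι in atTop, ∀ y ∈ t, dist (finProj s y) y < ε / 8 := by
    rw [eventually_all_finite htf]
    exact fun y _ => Metric.tendsto_nhds.1 (tendsto_finProj y) _ (by positivity)
  obtain ⟨s, hs⟩ := hev.exists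
  refine ⟨s, lt_of_le_of_lt (ContinuousLinearMap.opNorm_le_of_unit_norm (C := ε / 2)
    (by positivity) fun x hx => ?_) (by linarith)⟩
  have hkx : k x ∈ Q := hkQ ⟨x, by simp [hx], rfl⟩
  obtain ⟨y, hy, hxy⟩ : ∃ y ∈ t, dist (k x) y < ε / 8 := by simpa using ht hkx
  have h1 := hs y hy
  rw [dist_eq_norm] at h1 hxy
  have h2 := norm_finProj_apply_le s (k x - y)
  have h3 : (k - finProj s * k) x = (k x - y) - finProj s (k x - y) - (finProj s y - y) := by
    simp only [sub_apply, mul_apply_eq_comp, map_sub]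
    abel
  rw [h3]
  have h4 := norm_sub_le ((k x - y) - finProj s (k x - y)) (finProj s y - y)
  have h5 := norm_sub_le (k x - y) (finProj s (k x - y))
  linarith

/-- A closed subspace that contains the matrix units contains every compact operator. -/
theorem mem_of_isCompactOperator (U : Submodule ℂ (Op (L2 ι))) (hU : IsClosed (U : Set (Op (L2 ι))))
    (h : ∀ i j, matUnit i j ∈ U) {k : Op (L2 ι)} (hk : IsCompactOperator k) : k ∈ U := by
  -- The rank-one operator is conjugate linear and continuous in `y`, so expanding `y` in the basis
  -- reduces it to matrix units.
  have h1 : ∀ i (y : L2 ι), rankOne ℂ (basisVec i : L2 ι) y ∈ U := fun i y => by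
    have hs := (hasSum_basisVec y).map (rankOne ℂ (basisVec i : L2 ι)
      : L2 ι →L⋆[ℂ] L2 ι →L[ℂ] L2 ι) (rankOne ℂ (basisVec i : L2 ι)).continuous
    refine hU.mem_of_tendsto hs (Eventually.of_forall fun s => U.sum_mem fun j _ => ?_)
    simp only [Function.comp_apply, ContinuousLinearMap.map_smulₛₗ]
    exact U.smul_mem _ (h i j)
  have h2 : ∀ s : Finset ι, finProj s * k ∈ U := fun s => by
    unfold finProj
    rw [Finset.sum_mul]
    refine U.sum_mem fun i _ => ?_
    have : matUnit i i * k = rankOne ℂ (basisVec i : L2 ι) (star k (basisVec i)) :=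
      rankOne_comp _ _ _
    rw [this]
    exact h1 _ _
  rw [← SetLike.mem_coe, ← hU.closure_eq, Metric.mem_closure_iff]
  intro ε hε
  obtain ⟨s, hs⟩ := exists_finProj_mul_sub_lt hk hε
  exact ⟨_, h2 s, by rwa [dist_eq_norm]⟩

/-- Schauder's theorem on `ℓ²`: the operators with compact adjoint form a closed subspace containing
the matrix units, hence contain all compact operators. -/
theorem isCompactOperator_star {k : Op (L2 ι)} (hk : IsCompactOperator k) :
    IsCompactOperator (star k : Op (L2 ι)) := by
  let U : Submodule ℂ (Op (L2 ι)) :=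
    { carrier := {a | IsCompactOperator (star a : Op (L2 ι))}
      zero_mem' := by
        rw [Set.mem_ofPred_eq, star_zero]
        exact isCompactOperator_zero
      add_mem' := fun {a b} ha hb => by
        rw [Set.mem_ofPred_eq, star_add]
        exact IsCompactOperator.add ha hb
      smul_mem' := fun c a ha => by
        rw [Set.mem_ofPred_eq, star_smul]
        exact IsCompactOperator.smul ha (star c) }
  refine mem_of_isCompactOperator U ?_ (fun i j => ?_) hk
  · exact (isClosed_setOfPred_isCompactOperator (M₁ := L2 ι) (M₂ := L2 ι)
      (σ₁₂ := RingHom.id ℂ)).preimage (f := fun a : Op (L2 ι) => star a) continuous_star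
  · change IsCompactOperator (star (matUnit i j) : Op (L2 ι))
    rw [star_matUnit]
    exact isCompactOperator_matUnit _ _

end Compact

/-- The ideal of compact operators. -/
def compactIdeal (ι : Type*) : TwoSidedIdeal (Op (L2 ι)) :=
  TwoSidedIdeal.mk' {k : Op (L2 ι) | IsCompactOperator k} isCompactOperator_zero
    (fun ha hb => IsCompactOperator.add ha hb) (fun ha => IsCompactOperator.neg ha)
    (fun {a _} hb => IsCompactOperator.clm_comp hb a)
    (fun {_ b} ha => IsCompactOperator.comp_clm ha b)

theorem mem_compactIdeal {ι : Type*} {k : Op (L2 ι)} :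
    k ∈ compactIdeal ι ↔ IsCompactOperator k :=
  TwoSidedIdeal.mem_mk' ..

theorem isClosed_compactIdeal (ι : Type*) : IsClosed (compactIdeal ι : Set (Op (L2 ι))) := by
  have : (compactIdeal ι : Set (Op (L2 ι))) = {k : Op (L2 ι) | IsCompactOperator k} :=
    Set.ext fun _ => mem_compactIdeal
  rw [this]
  exact isClosed_setOfPred_isCompactOperator

/-! ### The Toeplitz algebra and pure isometries -/

theorem unilateralShift_basisVec (n : ℕ) :
    unilateralShift (basisVec n) = basisVec (n + 1) :=
  isometryOp_basisVec _ n

theorem star_unilateralShift_basisVec_succ (n : ℕ) :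
    star unilateralShift (basisVec (n + 1)) = basisVec n := by
  ext j
  rw [← inner_basisVec_left, ContinuousLinearMap.star_eq_adjoint,
    ContinuousLinearMap.adjoint_inner_right, unilateralShift_basisVec, inner_basisVec,
    basisVec_apply]
  simp

theorem star_unilateralShift_basisVec_zero :
    star unilateralShift (basisVec 0) = 0 := by
  ext j
  rw [← inner_basisVec_left, ContinuousLinearMap.star_eq_adjoint,
    ContinuousLinearMap.adjoint_inner_right, unilateralShift_basisVec, inner_basisVec]
  simp

instance isClosed_toeplitzAlgebra : IsClosed (toeplitzAlgebra : Set (Op (L2 ℕ))) :=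
  StarAlgebra.elemental.isClosed ℂ _

/-- Phrased on the subtype so that `P` may involve the values of a representation, which is defined
only on the algebra. -/
theorem toeplitz_induction {P : toeplitzAlgebra → Prop} (self : P genS) (star_self : P (star genS))
    (algebraMap : ∀ r, P (algebraMap ℂ _ r)) (add : ∀ u v, P u → P v → P (u + v))
    (mul : ∀ u v, P u → P v → P (u * v)) (closed : IsClosed {a | P a}) (a : toeplitzAlgebra) :
    P a := by
  obtain ⟨a, ha⟩ := a
  induction ha using StarAlgebra.elemental.induction_on with
  | self => exact self
  | star_self => exact star_self
  | algebraMap r => exact algebraMap r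
  | add u hu v hv h1 h2 => exact add ⟨u, hu⟩ ⟨v, hv⟩ h1 h2
  | mul u hu v hv h1 h2 => exact mul ⟨u, hu⟩ ⟨v, hv⟩ h1 h2
  | closure t ht h v hv =>
    have hv' : v ∈ toeplitzAlgebra :=
      closure_minimal ht isClosed_toeplitzAlgebra hv
    have : (⟨v, hv'⟩ : toeplitzAlgebra) ∈
        closure ((↑) ⁻¹' t : Set toeplitzAlgebra) := by
      rw [closure_subtype]
      rwa [show (((↑) : toeplitzAlgebra → Op (L2 ℕ)) '' ((↑) ⁻¹' t)) = t from
        Subtype.image_preimage_coe _ _ |>.trans (Set.inter_eq_right.2 ht)]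
    exact closure_minimal (fun u hu => h u.1 hu) closed this

theorem continuous_starAlgHom {A B : Type*} [CStarAlgebra A] [CStarAlgebra B]
    (φ : A →⋆ₐ[ℂ] B) : Continuous φ :=
  AddMonoidHomClass.continuous_of_bound φ 1 fun a => by
    simpa using NonUnitalStarAlgHom.norm_apply_le φ a

section Isometry

variable {G : Type*} [NormedAddCommGroup G] [InnerProductSpace ℂ G] [CompleteSpace G]

/-- Common factors `W` cancel since `W` is isometric; a leftover factor on one side crosses over as
`star W` and kills the other vector. -/
theorem inner_isometry_pow {W : Op G} (hW : star W * W = 1) {u v : G} (hu : star W u = 0)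
    (hv : star W v = 0) (i j : ℕ) :
    ⟪(W ^ i) u, (W ^ j) v⟫_ℂ = if i = j then ⟪u, v⟫_ℂ else 0 := by
  have hstep : ∀ x y, ⟪W x, W y⟫_ℂ = ⟪x, y⟫_ℂ := fun x y => by
    rw [← ContinuousLinearMap.adjoint_inner_right, ← ContinuousLinearMap.star_eq_adjoint,
      ← mul_apply_eq_comp, hW]
    rfl
  induction i generalizing j with
  | zero =>
    cases j with
    | zero => simp
    | succ j =>
      rw [pow_succ', mul_apply_eq_comp, ← ContinuousLinearMap.adjoint_inner_left,
        ← ContinuousLinearMap.star_eq_adjoint]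
      simp [hu]
  | succ i ih =>
    cases j with
    | zero =>
      rw [pow_succ', mul_apply_eq_comp, ← ContinuousLinearMap.adjoint_inner_right,
        ← ContinuousLinearMap.star_eq_adjoint]
      simp [hv]
    | succ j =>
      rw [pow_succ', pow_succ', mul_apply_eq_comp, mul_apply_eq_comp, hstep, ih]
      simp

theorem orthonormal_isometry_pow {W : Op G} (hW : star W * W = 1) {v : G} (hv : star W v = 0)
    (hv1 : ‖v‖ = 1) : Orthonormal ℂ fun n : ℕ => (W ^ n) v := by
  rw [orthonormal_iff_ite]
  intro i j
  rw [inner_isometry_pow hW hv hv, inner_self_eq_norm_sq_to_K, hv1]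
  simp

/-- The isometric embedding `e_n ↦ W ^ n v` of `ℓ²(ℕ)` given by a unit vector `v` in the
wandering space of an isometry `W`. -/
def wanderingEmb {W : Op G} (hW : star W * W = 1) {v : G} (hv : star W v = 0) (hv1 : ‖v‖ = 1) :
    L2 ℕ →ₗᵢ[ℂ] G :=
  (orthonormal_isometry_pow hW hv hv1).orthogonalFamily.linearIsometry

section Emb

variable {W : Op G} (hW : star W * W = 1) {v : G} (hv : star W v = 0) (hv1 : ‖v‖ = 1)

theorem wanderingEmb_basisVec (n : ℕ) : wanderingEmb hW hv hv1 (basisVec n) = (W ^ n) v := by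
  unfold wanderingEmb basisVec
  simp [OrthogonalFamily.linearIsometry_apply_single]

theorem wanderingEmb_shift :
    (wanderingEmb hW hv hv1).toContinuousLinearMap ∘L unilateralShift
      = W ∘L (wanderingEmb hW hv hv1).toContinuousLinearMap := by
  refine ext_basisVec fun n => ?_
  simp [unilateralShift_basisVec, wanderingEmb_basisVec, pow_succ']

theorem wanderingEmb_star_shift :
    (wanderingEmb hW hv hv1).toContinuousLinearMap ∘L star unilateralShift
      = star W ∘L (wanderingEmb hW hv hv1).toContinuousLinearMap := by
  refine ext_basisVec fun n => ?_
  cases n with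
  | zero => simp [star_unilateralShift_basisVec_zero, wanderingEmb_basisVec, hv]
  | succ n =>
    simp only [ContinuousLinearMap.comp_apply, star_unilateralShift_basisVec_succ,
      LinearIsometry.coe_toContinuousLinearMap, wanderingEmb_basisVec]
    rw [pow_succ', mul_apply_eq_comp, ← mul_apply_eq_comp (star W), hW]
    rfl

/-- A representation of the Toeplitz algebra that sends the shift to `W` restricts to the
identical representation on the copies of `ℓ²(ℕ)` generated by wandering vectors. -/
theorem wanderingEmb_intertwines (ρ : toeplitzAlgebra →⋆ₐ[ℂ] Op G) (hρ : ρ genS = W)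
    (a : toeplitzAlgebra) :
    (wanderingEmb hW hv hv1).toContinuousLinearMap ∘L (a : Op (L2 ℕ))
      = ρ a ∘L (wanderingEmb hW hv hv1).toContinuousLinearMap := by
  set V := (wanderingEmb hW hv hv1).toContinuousLinearMap
  refine toeplitz_induction (P := fun a => V ∘L (a : Op (L2 ℕ)) = ρ a ∘L V) ?_ ?_ ?_ ?_ ?_ ?_ a
  · rw [hρ]
    exact wanderingEmb_shift hW hv hv1
  · rw [map_star, hρ]
    exact wanderingEmb_star_shift hW hv hv1
  · intro r
    rw [AlgHomClass.commutes]
    ext x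
    simp [Algebra.algebraMap_eq_smul_one]
  · intro u v hu hv
    simp only [map_add, ContinuousLinearMap.add_comp, ← hu, ← hv]
    exact ContinuousLinearMap.comp_add _ _ _
  · intro u v hu hv
    simp only [map_mul, ContinuousLinearMap.mul_def, MulMemClass.coe_mul]
    rw [← ContinuousLinearMap.comp_assoc, hu, ContinuousLinearMap.comp_assoc, hv]
    rfl
  · have hc : Continuous ρ := continuous_starAlgHom ρ
    exact isClosed_eq (continuous_const.clm_comp continuous_subtype_val)
      (hc.clm_comp continuous_const)

end Emb

/-- The diagonal action of an operator on a Hilbert sum of copies of `ℓ²(ℕ)`. -/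
def amplification (κ : Type*) : Op (L2 ℕ) →⋆ₐ[ℂ] Op (lp (fun _ : κ => L2 ℕ) 2) where
  toFun a := lp.mapCLM 2 (fun _ => a) (norm_nonneg a) fun _ => le_rfl
  map_one' := rfl
  map_mul' _ _ := rfl
  map_zero' := rfl
  map_add' _ _ := rfl
  commutes' _ := rfl
  map_star' a := by
    refine (ContinuousLinearMap.eq_adjoint_iff _ _).2 fun x y => ?_
    rw [lp.inner_eq_tsum, lp.inner_eq_tsum]
    refine tsum_congr fun i => ?_
    exact ContinuousLinearMap.adjoint_inner_left a (y i) (x i)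

/-- An isometry without unitary part generates a quotient of the Toeplitz algebra. -/
theorem exists_toeplitz_rep {W : Op G} (hW : star W * W = 1)
    (hpure : ∀ x, (∀ k : ℕ, (W ^ k) ((star W ^ k) x) = x) → x = 0) :
    ∃ ρ : toeplitzAlgebra →⋆ₐ[ℂ] Op G, ρ genS = W := by
  classical
  -- An orthonormal basis of the wandering space `ker W*` labels the copies of `ℓ²(ℕ)` in the Wold
  -- decomposition.
  let K : Submodule ℂ G := LinearMap.ker (star W : G →L[ℂ] G).toLinearMap
  have hKc : IsClosed (K : Set G) := (star W).isClosed_ker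
  have : CompleteSpace K := hKc.completeSpace_coe
  obtain ⟨w, b, -⟩ := exists_hilbertBasis ℂ K
  have hb0 : ∀ i, star W (b i : G) = 0 := fun i => (b i).2
  have hb1 : ∀ i, ‖(b i : G)‖ = 1 := fun i => b.orthonormal.1 i
  let V : w → L2 ℕ →ₗᵢ[ℂ] G := fun i => wanderingEmb hW (hb0 i) (hb1 i)
  have hV : ∀ i n, V i (basisVec n) = (W ^ n) (b i : G) := fun i n =>
    wanderingEmb_basisVec hW (hb0 i) (hb1 i) n
  have horth : OrthogonalFamily ℂ (fun _ : w => L2 ℕ) V := by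
    intro i j hij x y
    have key : (V i).toContinuousLinearMap.adjoint ∘L (V j).toContinuousLinearMap = 0 := by
      refine ext_basisVec fun n => lp.ext (funext fun m => ?_)
      rw [← inner_basisVec_left, ContinuousLinearMap.comp_apply,
        ContinuousLinearMap.adjoint_inner_right]
      simp only [LinearIsometry.coe_toContinuousLinearMap, hV]
      rw [inner_isometry_pow hW (hb0 i) (hb0 j)]
      have : ⟪(b i : G), (b j : G)⟫_ℂ = 0 := b.orthonormal.2 hij
      simp [this]
    have := congrArg (fun T => ⟪x, T y⟫_ℂ) key
    simpa [ContinuousLinearMap.adjoint_inner_right] using this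
  -- If `x` is orthogonal to all copies, then every `(W*)^k x` is orthogonal to `ker W*` and so is
  -- fixed by `W W*`. Inductively `W^k (W*)^k x = x`, and `hpure` gives `x = 0`.
  have htot : ⊤ ≤ (⨆ i, LinearMap.range (V i).toLinearMap).topologicalClosure := by
    rw [top_le_iff, Submodule.topologicalClosure_eq_top_iff, Submodule.eq_bot_iff]
    intro x hx
    have h1 : ∀ i (k : ℕ), ⟪(b i : G), (star W ^ k) x⟫_ℂ = 0 := fun i k => by
      rw [← star_pow, ContinuousLinearMap.star_eq_adjoint,
        ContinuousLinearMap.adjoint_inner_right, ← hV i k]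
      exact (Submodule.mem_orthogonal _ _).1 hx _
        (Submodule.mem_iSup_of_mem i ⟨basisVec k, rfl⟩)
    have h2 : ∀ (u : K) (k : ℕ), ⟪(u : G), (star W ^ k) x⟫_ℂ = 0 := fun u k => by
      have hs := (b.hasSum_repr u).mapL (innerSL ℂ ((star W ^ k) x) ∘L K.subtypeL)
      have h0 : ⟪(star W ^ k) x, (u : G)⟫_ℂ = 0 := by
        refine hs.unique (hasSum_zero.congr_fun ?_)
        intro i
        change ⟪(star W ^ k) x, ((b.repr u i • b i : K) : G)⟫_ℂ = 0
        rw [Submodule.coe_smul, inner_smul_right, inner_eq_zero_symm.1 (h1 i k), mul_zero]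
      exact inner_eq_zero_symm.1 h0
    have h3 : ∀ k : ℕ, W (star W ((star W ^ k) x)) = (star W ^ k) x := fun k => by
      set y := (star W ^ k) x with hy
      -- The defect `y - W W* y` lies in `ker W*`, so it is orthogonal to `y` and to the range of
      -- `W`, hence to itself.
      have hu : star W (y - W (star W y)) = 0 := by
        rw [map_sub, ← mul_apply_eq_comp (star W) W, hW]
        simp
      have e1 := h2 ⟨_, hu⟩ k
      rw [← hy] at e1
      have e2 : ⟪y - W (star W y), W (star W y)⟫_ℂ = 0 := by
        rw [← ContinuousLinearMap.adjoint_inner_left, ← ContinuousLinearMap.star_eq_adjoint, hu,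
          inner_zero_left]
      have e3 : ⟪y - W (star W y), y - W (star W y)⟫_ℂ = 0 := by
        rw [inner_sub_right, e2, sub_zero]
        exact e1
      exact (sub_eq_zero.1 (inner_self_eq_zero.1 e3)).symm
    refine hpure x fun k => ?_
    induction k with
    | zero => simp
    | succ k ih =>
      rw [pow_succ, pow_succ', mul_apply_eq_comp, mul_apply_eq_comp, h3 k, ih]
  have hsum := IsHilbertSum.mk horth htot
  let U := hsum.linearIsometryEquiv
  refine ⟨(U.symm.conjStarAlgEquiv : Op (lp (fun _ : w => L2 ℕ) 2) →⋆ₐ[ℂ] Op G).comp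
    ((amplification w).comp toeplitzAlgebra.subtype), ?_⟩
  ext x
  obtain ⟨f, rfl⟩ := U.symm.surjective x
  have h1 := hsum.hasSum_linearIsometryEquiv_symm f
  have h2 := hsum.hasSum_linearIsometryEquiv_symm (amplification w unilateralShift f)
  have h3 := h1.mapL W
  have h4 : U.symm (amplification w unilateralShift (U (U.symm f))) = W (U.symm f) := by
    rw [LinearIsometryEquiv.apply_symm_apply]
    refine h2.unique (h3.congr_fun ?_)
    intro i
    exact congrArg (fun T => T (f i)) (wanderingEmb_shift hW (hb0 i) (hb1 i))
  exact h4

end Isometry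

/-! ### Vertices of the tree and their digits -/

section Vertex

/-- The root of the tree, that is the whole space of `s`-adic integers. -/
def root (s : ℕ) : Vertex s := ⟨0, ⟨0, by simp⟩⟩

theorem eq_root {s : ℕ} {v : Vertex s} (hv : v.1 = 0) : v = root s := by
  obtain ⟨n, x, hx⟩ := v
  obtain rfl : n = 0 := hv
  obtain rfl : x = 0 := by simpa using hx
  rfl

variable {s : ℕ} [NeZero s]

theorem ofNat_child_of_lt (v : Vertex s) (j : Fin s) {i : ℕ} (hi : i < v.1) :
    ofNat s (child v j).2 i = ofNat s v.2 i := by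
  have hs : 0 < s := Nat.pos_of_ne_zero (NeZero.ne s)
  apply Fin.ext
  simp only [ofNat, child, Fin.val_ofNat]
  obtain ⟨d, hd⟩ := Nat.exists_eq_add_of_lt hi
  have h1 : (v.2 : ℕ) + j * s ^ v.1 = v.2 + s ^ i * (s * (j * s ^ d)) := by
    have : j * s ^ v.1 = s ^ i * (s * (j * s ^ d)) := by
      rw [hd, pow_succ, pow_add]
      ring
    omega
  rw [h1, Nat.add_mul_div_left _ _ (pow_pos hs i), Nat.add_mul_mod_self_left]

theorem ofNat_child_self (v : Vertex s) (j : Fin s) : ofNat s (child v j).2 v.1 = j := by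
  have hs : 0 < s := Nat.pos_of_ne_zero (NeZero.ne s)
  apply Fin.ext
  simp only [ofNat, child, Fin.val_ofNat]
  rw [Nat.add_mul_div_right _ _ (pow_pos hs _), Nat.div_eq_of_lt v.2.isLt, zero_add,
    Nat.mod_eq_of_lt j.isLt]

theorem exists_eq_child {v : Vertex s} {n : ℕ} (hv : v.1 = n + 1) :
    ∃ u : Vertex s, u.1 = n ∧ ∃ j, v = child u j := by
  have hs : 0 < s := Nat.pos_of_ne_zero (NeZero.ne s)
  obtain ⟨k, x, hx⟩ := v
  obtain rfl : k = n + 1 := hv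
  refine ⟨⟨n, ⟨x % s ^ n, Nat.mod_lt _ (pow_pos hs n)⟩⟩, rfl, ⟨x / s ^ n, ?_⟩, ?_⟩
  · rw [Nat.div_lt_iff_lt_mul (pow_pos hs n), mul_comm, ← pow_succ]
    exact hx
  · simp only [child, Sigma.mk.injEq, true_and, heq_eq_eq, Fin.mk.injEq]
    rw [mul_comm]
    exact (Nat.mod_add_div x (s ^ n)).symm

theorem root_or_child (v : Vertex s) : v = root s ∨ ∃ u j, v = child u j := by
  rcases h : v.1 with _ | n
  · exact Or.inl (eq_root h)
  · obtain ⟨u, -, j, h⟩ := exists_eq_child h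
    exact Or.inr ⟨u, j, h⟩

theorem vertex_ext {v u : Vertex s} (h : v.1 = u.1)
    (hd : ∀ i < v.1, ofNat s v.2 i = ofNat s u.2 i) : v = u := by
  rcases hn : v.1 with _ | n
  · rw [eq_root hn, eq_root (h.symm.trans hn)]
  · obtain ⟨v', hv', j, rfl⟩ := exists_eq_child hn
    obtain ⟨u', hu', k, rfl⟩ := exists_eq_child (h ▸ hn)
    have hvu : v' = u' := vertex_ext (hv'.trans hu'.symm) fun i hi => by
      have := hd i (by change i < v'.1 + 1; omega)
      rwa [ofNat_child_of_lt _ _ hi, ofNat_child_of_lt _ _ (by omega)] at this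
    subst hvu
    have := hd v'.1 (by simp [child])
    rw [ofNat_child_self, ofNat_child_self] at this
    rw [this]
termination_by v.1
decreasing_by omega

theorem exists_vertex (x : SAdicInt s) (n : ℕ) :
    ∃ v : Vertex s, v.1 = n ∧ ∀ i < n, ofNat s v.2 i = x i := by
  induction n with
  | zero => exact ⟨root s, rfl, by simp⟩
  | succ n ih =>
    obtain ⟨v, rfl, hv⟩ := ih
    refine ⟨child v (x v.1), rfl, fun i hi => ?_⟩
    rcases Nat.lt_succ_iff_lt_or_eq.1 hi with h | rfl
    · rw [ofNat_child_of_lt _ _ h, hv i h]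
    · exact ofNat_child_self _ _

end Vertex

/-! ### Cylinder functions -/

section Cylinder

variable {s : ℕ}

/-- The first `m` digits. -/
def digits (m : ℕ) (x : SAdicInt s) : Fin m → Fin s := fun i => x i

theorem continuous_digits (m : ℕ) : Continuous (digits m : SAdicInt s → Fin m → Fin s) :=
  continuous_pi fun i => continuous_apply (i : ℕ)

/-- The indicator function of the ball of `s`-adic integers with given first digits. -/
def cyl (m : ℕ) (w : Fin m → Fin s) : C(SAdicInt s, ℂ) :=
  ⟨fun x => if digits m x = w then 1 else 0,
    (continuous_of_discreteTopology (f := fun u : Fin m → Fin s => if u = w then (1 : ℂ) else 0)).comp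
      (continuous_digits m)⟩

theorem cyl_apply (m : ℕ) (w : Fin m → Fin s) (x : SAdicInt s) :
    cyl m w x = if digits m x = w then 1 else 0 := rfl

theorem cyl_mul_cyl (m : ℕ) (w u : Fin m → Fin s) :
    cyl m w * cyl m u = if w = u then cyl m w else 0 := by
  ext x
  by_cases h : w = u
  · subst h
    simp [cyl_apply]
  · by_cases h1 : digits m x = w
    · simp [cyl_apply, h, h1]
    · simp [cyl_apply, h, h1]

theorem star_cyl (m : ℕ) (w : Fin m → Fin s) : star (cyl m w) = cyl m w := by
  ext x
  by_cases h : digits m x = w <;> simp [cyl_apply, h]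

theorem sum_cyl (m : ℕ) : ∑ w : Fin m → Fin s, cyl m w = 1 := by
  ext x
  simp [cyl_apply]

theorem cyl_eq_sum {m n : ℕ} (h : m ≤ n) (w : Fin m → Fin s) :
    cyl m w = ∑ u : Fin n → Fin s with (fun i => u (Fin.castLE h i)) = w, cyl n u := by
  ext x
  simp only [ContinuousMap.sum_apply, cyl_apply]
  rw [Finset.sum_filter]
  have : ∀ u : Fin n → Fin s, (if (fun i => u (Fin.castLE h i)) = w then
      (if digits n x = u then (1 : ℂ) else 0) else 0)
      = if digits n x = u then (if digits m x = w then 1 else 0) else 0 := fun u => by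
    by_cases hu : digits n x = u
    · subst hu
      rw [if_pos rfl, if_pos rfl]
      rfl
    · simp [hu]
  rw [Finset.sum_congr rfl fun u _ => this u]
  simp

theorem exists_digits_eq [NeZero s] (m : ℕ) (w : Fin m → Fin s) :
    ∃ x : SAdicInt s, digits m x = w :=
  ⟨fun i => if h : i < m then w ⟨i, h⟩ else 0, by ext i; simp [digits]⟩

/-- Continuous functions are uniformly approximated by combinations of cylinder functions. -/
theorem exists_step_approx [NeZero s] (f : C(SAdicInt s, ℂ)) {ε : ℝ} (hε : 0 < ε) :
    ∃ (m : ℕ) (c : (Fin m → Fin s) → ℂ), ‖f - ∑ w, c w • cyl m w‖ ≤ ε := by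
  have h1 : ∀ x : SAdicInt s, ∃ n, ∀ y ∈ PiNat.cylinder x n, dist (f y) (f x) < ε / 2 := by
    intro x
    have hU : (f : SAdicInt s → ℂ) ⁻¹' Metric.ball (f x) (ε / 2) ∈ 𝓝 x :=
      f.continuous.continuousAt (Metric.ball_mem_nhds _ (by positivity))
    obtain ⟨_, ⟨y, n, rfl⟩, hx, hsub⟩ :=
      (PiNat.isTopologicalBasis_cylinders (fun _ : ℕ => Fin s)).mem_nhds_iff.1 hU
    refine ⟨n, fun z hz => hsub ?_⟩
    rwa [← PiNat.mem_cylinder_iff_eq.1 hx]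
  choose n hn using h1
  obtain ⟨t, ht⟩ := CompactSpace.elim_nhds_subcover (fun x => PiNat.cylinder x (n x))
    fun x => (PiNat.isOpen_cylinder (fun _ : ℕ => Fin s) x (n x)).mem_nhds
      (PiNat.self_mem_cylinder x _)
  -- Points agreeing in the first `m` digits share a cylinder of the finite cover, on which `f`
  -- stays within `ε / 2` of its value at the centre.
  let m := t.sup n
  choose e he using fun w : Fin m → Fin s => exists_digits_eq m w
  refine ⟨m, fun w => f (e w), (ContinuousMap.norm_le _ hε.le).2 fun y => ?_⟩
  obtain ⟨x, hx, hy⟩ : ∃ x ∈ t, y ∈ PiNat.cylinder x (n x) := by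
    have : y ∈ (⊤ : Set (SAdicInt s)) := trivial
    rw [← ht] at this
    simpa using this
  have hy' : e (digits m y) ∈ PiNat.cylinder x (n x) := by
    intro i hi
    have h2 : i < m := hi.trans_le (Finset.le_sup (f := n) hx)
    have h3 := congrFun (he (digits m y)) ⟨i, h2⟩
    exact h3.trans (hy i hi)
  have e1 : (f - ∑ w, f (e w) • cyl m w) y = f y - f (e (digits m y)) := by
    simp [cyl_apply]
  rw [e1, ← dist_eq_norm]
  have h4 := hn x y hy
  have h5 := hn x _ hy'
  have h6 := dist_triangle_right (f y) (f (e (digits m y))) (f x)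
  linarith

end Cylinder

/-! ### The Serre shift -/

section Shift

variable {s : ℕ} [NeZero s]

variable (s) in
/-- The normalisation constant `s^(-1/2)`. -/
def normConst : ℂ := (((√(s : ℝ))⁻¹ : ℝ) : ℂ)

theorem normConst_ne_zero : normConst s ≠ 0 := by
  have hs : (0 : ℝ) < s := by exact_mod_cast Nat.pos_of_ne_zero (NeZero.ne s)
  have : (√(s : ℝ))⁻¹ ≠ 0 := inv_ne_zero (Real.sqrt_pos.2 hs).ne'
  exact Complex.ofReal_ne_zero.2 this

theorem star_normConst {p : ℕ} : star (normConst p) = normConst p := Complex.conj_ofReal _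

theorem serreShift_apply_root (x : L2 (Vertex s)) : serreShift s x (root s) = 0 := by
  have : innerSL ℂ (basisVec (root s)) ∘L serreShift s = 0 := by
    refine ext_basisVec fun v => ?_
    simp only [ContinuousLinearMap.comp_apply, serreShift_basisVec, innerSL_apply_apply,
      inner_smul_right, inner_sum, inner_basisVec, zero_apply]
    refine mul_eq_zero_of_right _ (Finset.sum_eq_zero fun j _ => if_neg fun h => ?_)
    exact absurd (congrArg Sigma.fst h) (Nat.succ_ne_zero _).symm
  rw [← inner_basisVec_left]
  exact congrArg (fun T => T x) this

theorem serreShift_apply_child (x : L2 (Vertex s)) (v : Vertex s) (j : Fin s) :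
    serreShift s x (child v j) = normConst s * x v := by
  have : innerSL ℂ (basisVec (child v j)) ∘L serreShift s
      = normConst s • innerSL ℂ (basisVec v) := by
    refine ext_basisVec fun u => ?_
    simp only [ContinuousLinearMap.comp_apply, serreShift_basisVec, innerSL_apply_apply,
      inner_smul_right, inner_sum, inner_basisVec, smul_apply, smul_eq_mul]
    congr 1
    by_cases h : v = u
    · subst h
      rw [Finset.sum_eq_single j (fun i _ hi => if_neg fun h => hi (child_injective h).2.symm)
        (by simp)]
      simp
    · rw [if_neg h]
      exact Finset.sum_eq_zero fun i _ => if_neg fun h' => h (child_injective h').1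
  rw [← inner_basisVec_left, ← inner_basisVec_left]
  exact congrArg (fun T => T x) this

/-- The image does not depend on `j`, so differences of siblings are wandering vectors. -/
theorem star_serreShift_child (v : Vertex s) (j : Fin s) :
    star (serreShift s) (basisVec (child v j)) = normConst s • basisVec v := by
  refine lp.ext (funext fun u => ?_)
  rw [← inner_basisVec_left, ContinuousLinearMap.star_eq_adjoint,
    ContinuousLinearMap.adjoint_inner_right, ← inner_conj_symm, inner_basisVec_left,
    serreShift_apply_child, lp.coeFn_smul, Pi.smul_apply, basisVec_apply, basisVec_apply]
  have := star_normConst (p := s)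
  by_cases h : v = u
  · subst h
    simpa using this
  · simp [h, Ne.symm h]

theorem star_serreShift_mul_self : star (serreShift s) * serreShift s = 1 := by
  refine (ContinuousLinearMap.isometry_iff_adjoint_comp_self _).1 ?_
  exact (orthonormal_serreVec s).orthogonalFamily.linearIsometry.isometry

theorem serreShift_pow_apply_eq_zero (k : ℕ) (x : L2 (Vertex s)) (v : Vertex s) (hv : v.1 < k) :
    (serreShift s ^ k) x v = 0 := by
  induction k generalizing v with
  | zero => omega
  | succ k ih =>
    rw [pow_succ', mul_apply_eq_comp]
    rcases root_or_child v with rfl | ⟨u, j, rfl⟩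
    · exact serreShift_apply_root _
    · rw [serreShift_apply_child, ih u (Nat.lt_of_succ_lt_succ hv), mul_zero]

variable (s) in
/-- The representation of the Toeplitz algebra on `ℓ²` of the tree given by the Serre shift. -/
theorem exists_serre_rep :
    ∃ ρ : toeplitzAlgebra →⋆ₐ[ℂ] Op (L2 (Vertex s)), ρ genS = serreShift s := by
  refine exists_toeplitz_rep star_serreShift_mul_self fun x hx => ?_
  -- The range of `W^k` is supported on levels at least `k`, so `k = v.1 + 1` kills the coordinate
  -- at `v`.
  refine lp.ext (funext fun v => ?_)
  rw [← hx (v.1 + 1)]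
  exact serreShift_pow_apply_eq_zero _ _ _ (Nat.lt_succ_self _)

/-! ### Multiplication operators -/

theorem multOp_apply (f : C(SAdicInt s, ℂ)) (x : L2 (Vertex s)) (v : Vertex s) :
    multOp f x v = f (ofNat s v.2) * x v := rfl

theorem multOp_basisVec (f : C(SAdicInt s, ℂ)) (v : Vertex s) :
    multOp f (basisVec v) = f (ofNat s v.2) • basisVec v := by
  refine lp.ext (funext fun u => ?_)
  rw [multOp_apply, lp.coeFn_smul, Pi.smul_apply, basisVec_apply]
  by_cases h : u = v
  · subst h
    rfl
  · simp [h]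

variable (s) in
/-- `f ↦ M_f` as a representation of the continuous functions. -/
def multHom : C(SAdicInt s, ℂ) →⋆ₐ[ℂ] Op (L2 (Vertex s)) where
  toFun := multOp
  map_one' := ext_basisVec fun v => by simp [multOp_basisVec]
  map_mul' f g := ext_basisVec fun v => by
    simp [multOp_basisVec, smul_smul, mul_comm]
  map_zero' := ext_basisVec fun v => by simp [multOp_basisVec]
  map_add' f g := ext_basisVec fun v => by simp [multOp_basisVec, add_smul]
  commutes' r := ext_basisVec fun v => by
    simp [multOp_basisVec, Algebra.algebraMap_eq_smul_one]
  map_star' f := by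
    refine (ContinuousLinearMap.eq_adjoint_iff _ _).2 fun x y => ?_
    rw [lp.inner_eq_tsum, lp.inner_eq_tsum]
    refine tsum_congr fun v => ?_
    simp only [multOp_apply, RCLike.inner_apply, ContinuousMap.star_apply, map_mul,
      RCLike.star_def, RCLike.conj_conj]
    ring

theorem multHom_apply (f : C(SAdicInt s, ℂ)) : multHom s f = multOp f := rfl

/-! ### Commutators with multiplication operators -/

variable (s) in
/-- The vertices of level less than `m`. -/
def levelsBelow (m : ℕ) : Finset (Vertex s) := (Finset.range m).sigma fun _ => Finset.univ

theorem mem_levelsBelow {p m : ℕ} {v : Vertex p} : v ∈ levelsBelow p m ↔ v.1 < m := by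
  simp [levelsBelow]

theorem isCompactOperator_finProj {ι : Type*} [DecidableEq ι] (t : Finset ι) :
    IsCompactOperator (finProj t : Op (L2 ι)) := by
  rw [← mem_compactIdeal]
  exact sum_mem fun i _ => mem_compactIdeal.2 (isCompactOperator_matUnit i i)

theorem isCompactOperator_of_finite {ι : Type*} [DecidableEq ι] {T : Op (L2 ι)} (t : Finset ι)
    (h : ∀ i ∉ t, T (basisVec i) = 0) : IsCompactOperator T := by
  have : T = T * finProj t := ext_basisVec fun i => by
    rw [mul_apply_eq_comp, finProj_apply]
    by_cases hi : i ∈ t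
    · simp [basisVec_apply, hi]
    · rw [h i hi, Finset.sum_eq_zero, map_zero]
      intro j hj
      rw [basisVec_apply, if_neg (by rintro rfl; exact hi hj), zero_smul]
  rw [← mem_compactIdeal, this]
  exact (compactIdeal ι).mul_mem_left _ _ (mem_compactIdeal.2 (isCompactOperator_finProj t))

theorem digits_child (v : Vertex s) (j : Fin s) {m : ℕ} (hm : m ≤ v.1) :
    digits m (ofNat s (child v j).2) = digits m (ofNat s v.2) :=
  funext fun i => ofNat_child_of_lt v j (i.2.trans_le hm)

/-- From level `m` on, children inherit the first `m` digits, so the commutator vanishes off the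
finitely many vertices below level `m`. -/
theorem commutator_shift_cyl (m : ℕ) (w : Fin m → Fin s) :
    serreShift s * multOp (cyl m w) - multOp (cyl m w) * serreShift s ∈
      compactIdeal (Vertex s) := by
  refine mem_compactIdeal.2 (isCompactOperator_of_finite (levelsBelow s m) fun v hv => ?_)
  rw [mem_levelsBelow, not_lt] at hv
  have h : ∀ j, cyl m w (ofNat s (child v j).2) = cyl m w (ofNat s v.2) := fun j => by
    rw [cyl_apply, cyl_apply, digits_child v j hv]
  simp only [sub_apply, mul_apply_eq_comp, multOp_basisVec, map_smul, serreShift_basisVec,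
    map_sum, h, ← Finset.smul_sum]
  rw [smul_comm, sub_self]

theorem commutator_shift_mult (f : C(SAdicInt s, ℂ)) :
    serreShift s * multOp f - multOp f * serreShift s ∈ compactIdeal (Vertex s) := by
  rw [← SetLike.mem_coe, ← (isClosed_compactIdeal _).closure_eq, Metric.mem_closure_iff]
  intro ε hε
  have hW : ‖serreShift s‖ ≤ 1 :=
    LinearIsometry.norm_toContinuousLinearMap_le _
  obtain ⟨m, c, hc⟩ := exists_step_approx f (ε := ε / 4) (by positivity)
  set g := ∑ w, c w • cyl m w
  refine ⟨serreShift s * multOp g - multOp g * serreShift s, ?_, ?_⟩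
  · have : serreShift s * multOp g - multOp g * serreShift s
        = ∑ w, (c w • (1 : Op (L2 (Vertex s)))) *
          (serreShift s * multOp (cyl m w) - multOp (cyl m w) * serreShift s) := by
      simp only [← multHom_apply, g, map_sum, map_smul, Finset.mul_sum, Finset.sum_mul,
        ← Finset.sum_sub_distrib, smul_mul_assoc, one_mul, mul_smul_comm, smul_sub]
    rw [this]
    exact sum_mem fun w _ => (compactIdeal _).mul_mem_left _ _ (commutator_shift_cyl m w)
  · have h1 : serreShift s * multOp f - multOp f * serreShift s
        - (serreShift s * multOp g - multOp g * serreShift s)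
        = serreShift s * multHom s (f - g) - multHom s (f - g) * serreShift s := by
      simp only [map_sub, multHom_apply]
      noncomm_ring
    have h2 : ‖multHom s (f - g)‖ ≤ ε / 4 := (NonUnitalStarAlgHom.norm_apply_le _ _).trans hc
    rw [dist_eq_norm, h1]
    have h3 := norm_sub_le (serreShift s * multHom s (f - g)) (multHom s (f - g) * serreShift s)
    have h4 := norm_mul_le (serreShift s) (multHom s (f - g))
    have h5 := norm_mul_le (multHom s (f - g)) (serreShift s)
    have h6 := mul_le_mul hW h2 (norm_nonneg _) zero_le_one
    have h7 := mul_le_mul h2 hW (norm_nonneg _) (by positivity)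
    linarith

theorem star_mem_compactIdeal {ι : Type*} {a : Op (L2 ι)} (ha : a ∈ compactIdeal ι) :
    star a ∈ compactIdeal ι := by
  classical
  exact mem_compactIdeal.2 (isCompactOperator_star (mem_compactIdeal.1 ha))

/-- The Toeplitz representation commutes with the multiplication operators modulo compacts. -/
theorem commutator_rep_mult (ρ : toeplitzAlgebra →⋆ₐ[ℂ] Op (L2 (Vertex s)))
    (hρ : ρ genS = serreShift s) (a : toeplitzAlgebra) (f : C(SAdicInt s, ℂ)) :
    ρ a * multHom s f - multHom s f * ρ a ∈ compactIdeal (Vertex s) := by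
  have hc : Continuous ρ := continuous_starAlgHom ρ
  revert f
  refine toeplitz_induction
    (P := fun a => ∀ f, ρ a * multHom s f - multHom s f * ρ a ∈ compactIdeal (Vertex s))
    ?_ ?_ ?_ ?_ ?_ ?_ a
  · intro f
    rw [hρ]
    exact commutator_shift_mult f
  · intro f
    -- The commutator of `W*` with `f` is minus the adjoint of the commutator of `W` with `star f`.
    have h := star_mem_compactIdeal (commutator_shift_mult (star f))
    have := (compactIdeal (Vertex s)).neg_mem h
    rw [map_star, hρ]
    convert this using 1
    rw [star_sub, star_mul, star_mul, ← multHom_apply, map_star, star_star]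
    abel
  · intro r f
    rw [AlgHomClass.commutes, Algebra.commutes r, sub_self]
    exact (compactIdeal _).zero_mem
  · intro u v hu hv f
    have := (compactIdeal _).add_mem (hu f) (hv f)
    convert this using 1
    rw [map_add]
    noncomm_ring
  · intro u v hu hv f
    have := (compactIdeal _).add_mem ((compactIdeal _).mul_mem_left (ρ u) _ (hv f))
      ((compactIdeal _).mul_mem_right _ (ρ v) (hu f))
    convert this using 1
    rw [map_mul]
    noncomm_ring
  · rw [Set.ofPred_forall]
    refine isClosed_iInter fun f => (isClosed_compactIdeal (Vertex s)).preimage ?_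
    fun_prop

end Shift

/-! ### The compact operators inside the shift algebra -/

section MatUnit

variable {ι : Type*} [DecidableEq ι]

theorem matUnit_mul_matUnit (i j k : ι) : matUnit i j * matUnit j k = matUnit i k := by
  refine ext_basisVec fun l => ?_
  simp only [matUnit, mul_apply_eq_comp, rankOne_apply, map_smul, inner_basisVec, if_true,
    one_smul]

theorem mul_matUnit (T : Op (L2 ι)) (i j : ι) :
    T * matUnit i j = rankOne ℂ (T (basisVec i)) (basisVec j) :=
  comp_rankOne _ _ _

theorem matUnit_mul (T : Op (L2 ι)) (i j : ι) :
    matUnit i j * T = rankOne ℂ (basisVec i) (star T (basisVec j)) :=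
  rankOne_comp _ _ _

end MatUnit

section Algebra

variable {s : ℕ} [NeZero s]

theorem isClosed_serreAlgebra : IsClosed (serreAlgebra s : Set (Op (L2 (Vertex s)))) :=
  StarSubalgebra.isClosed_topologicalClosure _

theorem serreShift_mem : serreShift s ∈ serreAlgebra s := (genW s).2

theorem multOp_mem (f : C(SAdicInt s, ℂ)) : multOp f ∈ serreAlgebra s := (genM f).2

/-- The root carries the number `0`, so the indicator of first digit `1` vanishes there, while among
its children it selects the one with digit `1`. From level `1` on the first digit is inherited and
the commutator vanishes. -/
theorem commutator_cyl_one (hs : 2 ≤ s) :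
    multOp (cyl 1 fun _ => ⟨1, hs⟩) * serreShift s - serreShift s * multOp (cyl 1 fun _ => ⟨1, hs⟩)
      = normConst s • matUnit (child (root s) ⟨1, hs⟩) (root s) := by
  refine ext_basisVec fun v => ?_
  have hr : cyl 1 (fun _ => (⟨1, hs⟩ : Fin s)) (ofNat s (root s).2) = 0 := by
    rw [cyl_apply, if_neg]
    intro h
    have := congrArg Fin.val (congrFun h 0)
    simp [digits, ofNat, root] at this
  have hc : ∀ j, cyl 1 (fun _ => (⟨1, hs⟩ : Fin s)) (ofNat s (child (root s) j).2)
      = if j = ⟨1, hs⟩ then 1 else 0 := fun j => by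
    rw [cyl_apply]
    congr 1
    refine propext ⟨fun h => ?_, fun h => funext fun i => ?_⟩
    · have := congrFun h 0
      exact (ofNat_child_self (root s) j).symm.trans this
    · have hi : i = 0 := Subsingleton.elim _ _
      subst hi
      exact (ofNat_child_self (root s) j).trans h
  simp only [sub_apply, mul_apply_eq_comp, multOp_basisVec, map_smul, serreShift_basisVec,
    map_sum, smul_apply, matUnit, rankOne_apply, inner_basisVec]
  rcases Nat.eq_zero_or_pos v.1 with h | h
  · obtain rfl := eq_root h
    simp only [hr, hc, zero_smul, sub_zero, if_true, one_smul, ite_smul, Finset.sum_ite_eq',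
      Finset.mem_univ]
    rfl
  · have hv : root s ≠ v := by
      rintro rfl
      exact absurd h (lt_irrefl 0)
    have h' : ∀ j, cyl 1 (fun _ => (⟨1, hs⟩ : Fin s)) (ofNat s (child v j).2)
        = cyl 1 (fun _ => (⟨1, hs⟩ : Fin s)) (ofNat s v.2) := fun j => by
      rw [cyl_apply, cyl_apply, digits_child v j h]
    simp only [h', if_neg hv, zero_smul, smul_zero, ← Finset.smul_sum]
    rw [smul_comm, sub_self]

theorem matUnit_root_root_mem (hs : 2 ≤ s) : matUnit (root s) (root s) ∈ serreAlgebra s := by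
  have h1 : normConst s • matUnit (child (root s) ⟨1, hs⟩) (root s) ∈ serreAlgebra s := by
    rw [← commutator_cyl_one hs]
    exact sub_mem (mul_mem (multOp_mem _) serreShift_mem) (mul_mem serreShift_mem (multOp_mem _))
  have h2 : matUnit (child (root s) ⟨1, hs⟩) (root s) ∈ serreAlgebra s := by
    have := SMulMemClass.smul_mem (normConst s)⁻¹ h1
    rwa [inv_smul_smul₀ normConst_ne_zero] at this
  have := mul_mem (star_mem h2) h2
  rwa [star_matUnit, matUnit_mul_matUnit] at this

theorem serreShift_pow_root (n : ℕ) (v : Vertex s) :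
    (serreShift s ^ n) (basisVec (root s)) v = if v.1 = n then normConst s ^ n else 0 := by
  induction n generalizing v with
  | zero =>
    rw [pow_zero, one_apply_eq_self, basisVec_apply, pow_zero]
    refine if_congr ⟨?_, eq_root⟩ rfl rfl
    rintro rfl
    rfl
  | succ n ih =>
    rw [pow_succ' (serreShift s), mul_apply_eq_comp]
    rcases root_or_child v with rfl | ⟨u, j, rfl⟩
    · rw [serreShift_apply_root]
      exact (if_neg (Nat.succ_ne_zero n).symm).symm
    · rw [serreShift_apply_child, ih, mul_ite, mul_zero, ← pow_succ']
      exact if_congr (Nat.succ_inj (a := u.1)).symm rfl rfl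

theorem matUnit_mem (hs : 2 ≤ s) (v w : Vertex s) : matUnit v w ∈ serreAlgebra s := by
  have key : ∀ v : Vertex s, matUnit v (root s) ∈ serreAlgebra s := fun v => by
    -- `W ^ v.1` spreads the root evenly over the level of `v`, and the cylinder of the digits of
    -- `v` singles out `v` there.
    have h1 : multOp (cyl v.1 (digits v.1 (ofNat s v.2))) * serreShift s ^ v.1
        * matUnit (root s) (root s) = normConst s ^ v.1 • matUnit v (root s) := by
      rw [mul_matUnit]
      have : (multOp (cyl v.1 (digits v.1 (ofNat s v.2))) * serreShift s ^ v.1)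
          (basisVec (root s)) = normConst s ^ v.1 • basisVec v := by
        refine lp.ext (funext fun u => ?_)
        rw [mul_apply_eq_comp, multOp_apply, serreShift_pow_root, lp.coeFn_smul, Pi.smul_apply,
          basisVec_apply, cyl_apply]
        by_cases h : u = v
        · subst h
          simp
        · by_cases h1 : u.1 = v.1
          · rw [if_neg (c := digits _ _ = _), if_neg h]
            · simp
            · intro hd
              exact h (vertex_ext h1 fun i hi => congrFun hd ⟨i, h1 ▸ hi⟩)
          · simp [h, h1]
      rw [this, map_smul]
      rfl
    have h2 : normConst s ^ v.1 • matUnit v (root s) ∈ serreAlgebra s := by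
      rw [← h1]
      exact mul_mem (mul_mem (multOp_mem _) (pow_mem serreShift_mem _)) (matUnit_root_root_mem hs)
    have := SMulMemClass.smul_mem (normConst s ^ v.1)⁻¹ h2
    rwa [inv_smul_smul₀ (pow_ne_zero _ normConst_ne_zero)] at this
  have := mul_mem (key v) (star_mem (key w))
  rwa [star_matUnit, matUnit_mul_matUnit] at this

theorem compact_mem_serreAlgebra (hs : 2 ≤ s) {k : Op (L2 (Vertex s))}
    (hk : IsCompactOperator k) : k ∈ serreAlgebra s :=
  mem_of_isCompactOperator (serreAlgebra s).toSubalgebra.toSubmodule isClosed_serreAlgebra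
    (matUnit_mem hs) hk

/-! ### The ideal `𝓘_W` -/

theorem gaugeUnitary_basisVec {p : ℕ} (θ : ℝ) (v : Vertex p) :
    gaugeUnitary p θ (basisVec v)
      = Complex.exp ((2 * Real.pi * v.1 * θ : ℝ) * Complex.I) • basisVec v := by
  refine lp.ext (funext fun u => ?_)
  change Complex.exp ((2 * Real.pi * u.1 * θ : ℝ) * Complex.I) * basisVec v u = _
  rw [lp.coeFn_smul, Pi.smul_apply, basisVec_apply]
  by_cases h : u = v
  · subst h
    rfl
  · simp [h]

/-- The gauge phases depend only on the level, so they cancel. -/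
theorem matUnit_mem_gaugeInvCompact {p : ℕ} {v w : Vertex p} (h : v.1 = w.1) :
    matUnit v w ∈ gaugeInvCompact p := by
  refine ⟨isCompactOperator_matUnit v w, fun θ => ?_⟩
  have h1 : gaugeUnitary p θ * matUnit v w * star (gaugeUnitary p θ)
      = rankOne ℂ (gaugeUnitary p θ (basisVec v)) (gaugeUnitary p θ (basisVec w)) := by
    rw [mul_matUnit, ContinuousLinearMap.mul_def, rankOne_comp, ContinuousLinearMap.star_eq_adjoint,
      ContinuousLinearMap.adjoint_adjoint]
  have h2 := Complex.norm_exp_ofReal_mul_I (2 * Real.pi * w.1 * θ)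
  rw [h1, gaugeUnitary_basisVec, gaugeUnitary_basisVec, h]
  set z := Complex.exp ((2 * Real.pi * w.1 * θ : ℝ) * Complex.I)
  have h3 : rankOne ℂ (z • basisVec v : L2 (Vertex p)) (z • basisVec w : L2 (Vertex p))
      = (z * star z) • matUnit v w := by
    rw [ContinuousLinearMap.map_smulₛₗ, map_smul, smul_apply, smul_smul, mul_comm]
    rfl
  rw [h3, RCLike.star_def, RCLike.mul_conj, h2]
  simp

theorem exists_descendant (w : Vertex s) (k : ℕ) : ∃ v : Vertex s, v.1 = w.1 + k ∧
    (star (serreShift s) ^ k) (basisVec v) = normConst s ^ k • basisVec w := by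
  induction k with
  | zero => exact ⟨w, rfl, by simp⟩
  | succ k ih =>
    obtain ⟨v, hv, h⟩ := ih
    refine ⟨child v 0, congrArg Nat.succ hv, ?_⟩
    rw [pow_succ, mul_apply_eq_comp, star_serreShift_child, map_smul, h, smul_smul, ← pow_succ']

/-- If `w` is not deeper than `v`, it has a descendant `u` on the level of `v`. Then `|E_v⟩⟨E_u|` is
gauge invariant, and a power of `W` on its right carries `E_u` back to a multiple of `E_w`. Adjoints
cover the other case. -/
theorem matUnit_mem_serreIdeal (v w : Vertex s) : matUnit v w ∈ serreIdeal s := by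
  have key : ∀ v w : Vertex s, w.1 ≤ v.1 → matUnit v w ∈ serreIdeal s := fun v w h => by
    obtain ⟨u, hu, h1⟩ := exists_descendant w (v.1 - w.1)
    set k := v.1 - w.1
    have h2 : matUnit v u * serreShift s ^ k ∈ serreIdeal s :=
      NonUnitalStarSubalgebra.le_topologicalClosure _ (NonUnitalStarAlgebra.subset_adjoin ℂ _
        ⟨_, matUnit_mem_gaugeInvCompact (by omega), k, rfl⟩)
    have h3 : matUnit v u * serreShift s ^ k = star (normConst s ^ k) • matUnit v w := by
      rw [matUnit_mul, star_pow, h1, ContinuousLinearMap.map_smulₛₗ]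
      rfl
    have h4 : star (normConst s ^ k) ≠ 0 := star_ne_zero.2 (pow_ne_zero _ normConst_ne_zero)
    rw [h3] at h2
    have := SMulMemClass.smul_mem (star (normConst s ^ k))⁻¹ h2
    rwa [inv_smul_smul₀ h4] at this
  rcases le_total w.1 v.1 with h | h
  · exact key v w h
  · have := star_mem (key w v h)
    rwa [star_matUnit] at this

theorem mem_serreIdeal_iff (k : Op (L2 (Vertex s))) :
    k ∈ serreIdeal s ↔ IsCompactOperator k := by
  constructor
  · let C : NonUnitalStarSubalgebra ℂ (Op (L2 (Vertex s))) :=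
      { carrier := compactIdeal (Vertex s)
        add_mem' := fun ha hb => (compactIdeal (Vertex s)).add_mem ha hb
        zero_mem' := (compactIdeal (Vertex s)).zero_mem
        mul_mem' := fun {a b} _ hb => (compactIdeal (Vertex s)).mul_mem_left a b hb
        smul_mem' := fun c a ha => by
          have := (compactIdeal (Vertex s)).mul_mem_left (c • 1) a ha
          rwa [smul_one_mul] at this
        star_mem' := fun ha => star_mem_compactIdeal ha }
    have hC : serreIdeal s ≤ C := by
      refine NonUnitalStarSubalgebra.topologicalClosure_minimal _
        (NonUnitalStarAlgebra.adjoin_le ?_) (isClosed_compactIdeal (Vertex s))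
      rintro _ ⟨a, ha, n, rfl⟩
      exact (compactIdeal (Vertex s)).mul_mem_right a _ (mem_compactIdeal.2 ha.1)
    exact fun hk => mem_compactIdeal.1 (hC hk)
  · exact mem_of_isCompactOperator (serreIdeal s).toNonUnitalSubalgebra.toSubmodule
      (NonUnitalStarSubalgebra.isClosed_topologicalClosure _) matUnit_mem_serreIdeal

end Algebra

/-! ### Wandering vectors deep inside a ball -/

section Wandering

variable {s : ℕ} [NeZero s]

/-- The vector is the normalised difference of two children of a vertex `t` deep inside the ball of
`w`; `W*` maps both children to the same vector. -/
theorem exists_wandering_vector (hs : 2 ≤ s) (m : ℕ) (w : Fin m → Fin s) (N : ℕ) :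
    ∃ v : L2 (Vertex s), ‖v‖ = 1 ∧ star (serreShift s) v = 0 ∧
      ∀ u : Vertex s, ¬ (N ≤ u.1 ∧ m ≤ u.1 ∧ digits m (ofNat s u.2) = w) → v u = 0 := by
  obtain ⟨x, hx⟩ := exists_digits_eq m w
  obtain ⟨t, ht, htx⟩ := exists_vertex x (max m N)
  have hm : m ≤ t.1 := ht ▸ le_max_left m N
  have hN : N ≤ t.1 := ht ▸ le_max_right m N
  have htw : digits m (ofNat s t.2) = w := by
    rw [← hx]
    exact funext fun i => htx i (by rw [← ht]; exact i.2.trans_le hm)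
  let a : L2 (Vertex s) := basisVec (child t ⟨0, by omega⟩)
  let b : L2 (Vertex s) := basisVec (child t ⟨1, hs⟩)
  have hab : ⟪a, b⟫_ℂ = 0 := by
    rw [inner_basisVec, if_neg]
    intro h
    simpa using (child_injective h).2
  have hne : a - b ≠ 0 := by
    intro h
    rw [sub_eq_zero.1 h, inner_self_eq_zero] at hab
    have := norm_basisVec (child t (⟨1, hs⟩ : Fin s))
    rw [show basisVec (child t (⟨1, hs⟩ : Fin s)) = b from rfl, hab, norm_zero] at this
    exact zero_ne_one this
  refine ⟨((‖a - b‖⁻¹ : ℝ) : ℂ) • (a - b), ?_, ?_, fun u hu => ?_⟩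
  · rw [norm_smul, Complex.norm_real, norm_inv, norm_norm, inv_mul_cancel₀ (norm_ne_zero_iff.2 hne)]
  · rw [map_smul, map_sub, star_serreShift_child, star_serreShift_child, sub_self, smul_zero]
  · have h : ∀ j, u ≠ child t j := by
      rintro j rfl
      refine hu ⟨hN.trans (Nat.le_succ _), hm.trans (Nat.le_succ _), ?_⟩
      rw [digits_child t j hm, htw]
    rw [lp.coeFn_smul, Pi.smul_apply, lp.coeFn_sub, Pi.sub_apply, basisVec_apply, basisVec_apply,
      if_neg (h _), if_neg (h _), sub_zero, smul_zero]

/-- `W` moves mass only from a vertex to its children, so a support inside a set closed under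
descendants stays there. -/
theorem serreShift_pow_apply_eq_zero_of {P : Vertex s → Prop} (hP : ∀ u j, P u → P (child u j))
    {v : L2 (Vertex s)} (hv : ∀ u, ¬ P u → v u = 0) (n : ℕ) (u : Vertex s) (hu : ¬ P u) :
    (serreShift s ^ n) v u = 0 := by
  induction n generalizing u with
  | zero => exact hv u hu
  | succ n ih =>
    rw [pow_succ', mul_apply_eq_comp]
    rcases root_or_child u with rfl | ⟨t, j, rfl⟩
    · exact serreShift_apply_root _
    · rw [serreShift_apply_child, ih t fun h => hu (hP t j h), mul_zero]

theorem wanderingEmb_apply_eq_zero {P : Vertex s → Prop} (hP : ∀ u j, P u → P (child u j))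
    {v : L2 (Vertex s)} (hv : ∀ u, ¬ P u → v u = 0) (h0 : star (serreShift s) v = 0)
    (h1 : ‖v‖ = 1) (x : L2 ℕ) (u : Vertex s) (hu : ¬ P u) :
    wanderingEmb star_serreShift_mul_self h0 h1 x u = 0 := by
  have : innerSL ℂ (basisVec u) ∘L
      (wanderingEmb star_serreShift_mul_self h0 h1).toContinuousLinearMap = 0 := by
    refine ext_basisVec fun n => ?_
    simp only [ContinuousLinearMap.comp_apply, LinearIsometry.coe_toContinuousLinearMap,
      wanderingEmb_basisVec, innerSL_apply_apply, inner_basisVec_left, zero_apply]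
    exact serreShift_pow_apply_eq_zero_of hP hv n u hu
  rw [← inner_basisVec_left]
  exact congrArg (fun T => T x) this

end Wandering

/-! ### Operators on a Hilbert space tensor product -/

section Tensor

variable {E F : Type*} [NormedAddCommGroup E] [InnerProductSpace ℂ E]
  [NormedAddCommGroup F] [InnerProductSpace ℂ F]

theorem hilbertTensor_ext {G : Type*} [NormedAddCommGroup G] [NormedSpace ℂ G]
    {S T : HilbertTensor E F →L[ℂ] G}
    (h : ∀ (x : E) (y : F), S ((x ⊗ₜ[ℂ] y : E ⊗[ℂ] F) : HilbertTensor E F)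
      = T ((x ⊗ₜ[ℂ] y : E ⊗[ℂ] F) : HilbertTensor E F)) : S = T := by
  ext z
  induction z using UniformSpace.Completion.induction_on with
  | hp => exact isClosed_eq S.continuous T.continuous
  | ih z =>
    induction z using TensorProduct.induction_on with
    | zero => simp [UniformSpace.Completion.coe_zero]
    | tmul x y => exact h x y
    | add x y hx hy => rw [UniformSpace.Completion.coe_add, map_add, map_add, hx, hy]

theorem opTensor_mul (a b : Op E) (c d : Op F) :
    opTensor a c * opTensor b d = opTensor (a * b) (c * d) :=
  hilbertTensor_ext fun x y => by simp [opTensor_tmul]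

theorem opTensor_one : opTensor (1 : Op E) (1 : Op F) = 1 :=
  hilbertTensor_ext fun x y => by simp [opTensor_tmul]

theorem opTensor_add_left (a b : Op E) (c : Op F) :
    opTensor (a + b) c = opTensor a c + opTensor b c :=
  hilbertTensor_ext fun x y => by
    simp [opTensor_tmul, TensorProduct.add_tmul, UniformSpace.Completion.coe_add]

theorem opTensor_add_right (a : Op E) (c d : Op F) :
    opTensor a (c + d) = opTensor a c + opTensor a d :=
  hilbertTensor_ext fun x y => by
    simp [opTensor_tmul, TensorProduct.tmul_add, UniformSpace.Completion.coe_add]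

theorem opTensor_smul_left (r : ℂ) (a : Op E) (c : Op F) :
    opTensor (r • a) c = r • opTensor a c :=
  hilbertTensor_ext fun x y => by
    simp only [opTensor_tmul, smul_apply]
    rw [← TensorProduct.smul_tmul', UniformSpace.Completion.coe_smul]

theorem opTensor_smul_right (r : ℂ) (a : Op E) (c : Op F) :
    opTensor a (r • c) = r • opTensor a c :=
  hilbertTensor_ext fun x y => by
    simp [opTensor_tmul, TensorProduct.tmul_smul, UniformSpace.Completion.coe_smul]

/-- Test on the vectors `x ⊗ p z` with `p z ≠ 0`, whose second factor `p` fixes. -/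
theorem norm_le_norm_opTensor_idempotent (a : Op E) {p : Op F} (hp : p * p = p) (hp0 : p ≠ 0) :
    ‖a‖ ≤ ‖opTensor a p‖ := by
  obtain ⟨z, hz⟩ : ∃ z, p z ≠ 0 := by
    by_contra h
    push Not at h
    exact hp0 (ContinuousLinearMap.ext h)
  have hpz : p (p z) = p z := by rw [← mul_apply_eq_comp, hp]
  refine ContinuousLinearMap.opNorm_le_bound _ (norm_nonneg _) fun x => ?_
  have h := (opTensor a p).le_opNorm ((x ⊗ₜ[ℂ] p z : E ⊗[ℂ] F) : HilbertTensor E F)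
  rw [opTensor_tmul, UniformSpace.Completion.norm_coe, UniformSpace.Completion.norm_coe,
    TensorProduct.norm_tmul, TensorProduct.norm_tmul, hpz, ← mul_assoc] at h
  exact le_of_mul_le_mul_right h (norm_pos_iff.2 hz)

variable [CompleteSpace E] [CompleteSpace F]

theorem star_opTensor (a : Op E) (c : Op F) :
    star (opTensor a c) = opTensor (star a) (star c) := by
  symm
  refine (ContinuousLinearMap.eq_adjoint_iff _ _).2 fun x y => ?_
  induction x, y using UniformSpace.Completion.induction_on₂ with
  | hp => exact isClosed_eq (by fun_prop) (by fun_prop)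
  | ih x y =>
    induction x using TensorProduct.induction_on with
    | zero => simp [UniformSpace.Completion.coe_zero]
    | add x x' hx hx' =>
      rw [UniformSpace.Completion.coe_add, map_add, inner_add_left, inner_add_left, hx, hx']
    | tmul x x' =>
      induction y using TensorProduct.induction_on with
      | zero => simp [UniformSpace.Completion.coe_zero]
      | add y y' hy hy' =>
        rw [UniformSpace.Completion.coe_add, map_add, inner_add_right, inner_add_right, hy, hy']
      | tmul y y' =>
        simp only [opTensor_tmul, UniformSpace.Completion.inner_coe, TensorProduct.inner_tmul,
          ContinuousLinearMap.star_eq_adjoint, ContinuousLinearMap.adjoint_inner_left]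

variable (E F) in
/-- `a ↦ a ⊗ 1`. -/
def leftTensor : Op E →⋆ₐ[ℂ] Op (HilbertTensor E F) where
  toFun a := opTensor a 1
  map_one' := opTensor_one
  map_mul' a b := by rw [opTensor_mul, one_mul]
  map_zero' := by simpa using opTensor_smul_left 0 (0 : Op E) (1 : Op F)
  map_add' a b := opTensor_add_left a b 1
  commutes' r := by
    rw [Algebra.algebraMap_eq_smul_one, Algebra.algebraMap_eq_smul_one, opTensor_smul_left,
      opTensor_one]
  map_star' a := by rw [star_opTensor, star_one]

variable (E F) in
/-- `c ↦ 1 ⊗ c`. -/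
def rightTensor : Op F →⋆ₐ[ℂ] Op (HilbertTensor E F) where
  toFun c := opTensor 1 c
  map_one' := opTensor_one
  map_mul' a b := by rw [opTensor_mul, one_mul]
  map_zero' := by simpa using opTensor_smul_right 0 (1 : Op E) (0 : Op F)
  map_add' a b := opTensor_add_right 1 a b
  commutes' r := by
    rw [Algebra.algebraMap_eq_smul_one, Algebra.algebraMap_eq_smul_one, opTensor_smul_right,
      opTensor_one]
  map_star' a := by rw [star_opTensor, star_one]

theorem leftTensor_mul_rightTensor (a : Op E) (c : Op F) :
    leftTensor E F a * rightTensor E F c = opTensor a c := by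
  change opTensor a 1 * opTensor 1 c = _
  rw [opTensor_mul, mul_one, one_mul]

theorem rightTensor_mul_leftTensor (a : Op E) (c : Op F) :
    rightTensor E F c * leftTensor E F a = opTensor a c := by
  change opTensor 1 c * opTensor a 1 = _
  rw [opTensor_mul, mul_one, one_mul]

end Tensor

/-! ### Block diagonal operators -/

section Block

variable {G : Type*} [NormedAddCommGroup G] [InnerProductSpace ℂ G] [CompleteSpace G]
  {I : Type*} [Fintype I] [DecidableEq I]

theorem norm_sum_proj_sq {p : I → Op G} (hs : ∀ i, star (p i) = p i)
    (hp : ∀ i j, p i * p j = if i = j then p i else 0) (z : I → G) :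
    ‖∑ i, p i (z i)‖ ^ 2 = ∑ i, ‖p i (z i)‖ ^ 2 := by
  have h0 : ∀ i j, i ≠ j → ⟪p i (z i), p j (z j)⟫_ℂ = 0 := fun i j hij => by
    rw [← hs i, ContinuousLinearMap.star_eq_adjoint, ContinuousLinearMap.adjoint_inner_left,
      ← mul_apply_eq_comp, hp, if_neg hij]
    simp
  apply Complex.ofReal_injective
  push_cast
  have h1 := inner_self_eq_norm_sq_to_K (𝕜 := ℂ) (∑ i, p i (z i))
  have h2 : ∀ i, ⟪p i (z i), p i (z i)⟫_ℂ = ((‖p i (z i)‖ : ℝ) : ℂ) ^ 2 := fun i =>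
    inner_self_eq_norm_sq_to_K (𝕜 := ℂ) (p i (z i))
  refine h1.symm.trans ?_
  rw [sum_inner]
  refine Finset.sum_congr rfl fun i _ => ?_
  rw [inner_sum, Finset.sum_eq_single i (fun j _ hj => h0 i j hj.symm) (by simp), h2]

/-- A block diagonal operator is bounded by the norms of its blocks. -/
theorem norm_sum_block_le {p : I → Op G} (hs : ∀ i, star (p i) = p i)
    (hp : ∀ i j, p i * p j = if i = j then p i else 0) (hsum : ∑ i, p i = 1)
    (c : I → Op G) {C : ℝ} (hC : 0 ≤ C) (hc : ∀ i, ‖c i‖ ≤ C) :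
    ‖∑ i, p i * c i * p i‖ ≤ C := by
  have hp1 : ∀ i x, ‖p i x‖ ≤ ‖x‖ := fun i x => by
    have h := norm_sum_proj_sq hs hp fun _ => x
    rw [← sum_apply, hsum, one_apply_eq_self] at h
    have h2 := Finset.single_le_sum (f := fun i => ‖p i x‖ ^ 2) (fun i _ => by positivity)
      (Finset.mem_univ i)
    rw [← h] at h2
    exact le_of_sq_le_sq h2 (norm_nonneg _)
  refine ContinuousLinearMap.opNorm_le_bound _ hC fun x => ?_
  have h1 := norm_sum_proj_sq hs hp fun i => c i (p i x)
  have h2 := norm_sum_proj_sq hs hp fun _ => x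
  rw [← sum_apply, hsum, one_apply_eq_self] at h2
  have h3 : ‖∑ i, p i (c i (p i x))‖ ^ 2 ≤ (C * ‖x‖) ^ 2 := by
    rw [h1, mul_pow, h2, Finset.mul_sum]
    refine Finset.sum_le_sum fun i _ => ?_
    rw [← mul_pow]
    refine pow_le_pow_left₀ (norm_nonneg _) ((hp1 i _).trans ?_) 2
    exact (c i).le_of_opNorm_le (hc i) _
  rw [sum_apply]
  exact le_of_sq_le_sq h3 (by positivity)

end Block

/-! ### Combinations of cylinder functions with coefficients in the Toeplitz algebra -/

section Step

variable {s : ℕ} {A : Type*} [Ring A] [StarRing A] [Algebra ℂ A]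
  (ρ : toeplitzAlgebra →⋆ₐ[ℂ] A) (μ : C(SAdicInt s, ℂ) →⋆ₐ[ℂ] A)

/-- The element `∑_w ρ (b w) μ (1_w)` given by a function of the first `m` digits with values in
the Toeplitz algebra. -/
def stepSum (m : ℕ) (b : (Fin m → Fin s) → toeplitzAlgebra) : A := ∑ w, ρ (b w) * μ (cyl m w)

/-- Brings step sums of different depths to a common depth, where they can be added and multiplied.
-/
theorem stepSum_refine {m n : ℕ} (h : m ≤ n) (b : (Fin m → Fin s) → toeplitzAlgebra) :
    stepSum ρ μ n (fun u => b fun i => u (Fin.castLE h i)) = stepSum ρ μ m b := by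
  unfold stepSum
  simp only [cyl_eq_sum h, map_sum, Finset.mul_sum]
  rw [← Finset.sum_fiberwise (s := Finset.univ)
    (g := fun (u : Fin n → Fin s) => fun i : Fin m => u (Fin.castLE h i))]
  refine Finset.sum_congr rfl fun w _ => Finset.sum_congr rfl fun u hu => ?_
  rw [(Finset.mem_filter.1 hu).2]

theorem stepSum_add (m : ℕ) (b c : (Fin m → Fin s) → toeplitzAlgebra) :
    stepSum ρ μ m (b + c) = stepSum ρ μ m b + stepSum ρ μ m c := by
  simp only [stepSum, Pi.add_apply, map_add, add_mul, Finset.sum_add_distrib]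

theorem stepSum_const (m : ℕ) (a : toeplitzAlgebra) : stepSum ρ μ m (fun _ => a) = ρ a := by
  rw [stepSum, ← Finset.mul_sum, ← map_sum, sum_cyl, map_one, mul_one]

variable {ρ μ} {J : TwoSidedIdeal A}

/-- Modulo `J` the factor `μ (cyl m w)` moves past `ρ (c u)`; since cylinders are orthogonal
idempotents, only the terms with `w = u` remain. -/
theorem stepSum_mul_sub_mem (hJ : ∀ a f, ρ a * μ f - μ f * ρ a ∈ J) (m : ℕ) (b c : (Fin m → Fin s) → toeplitzAlgebra) :
    stepSum ρ μ m b * stepSum ρ μ m c - stepSum ρ μ m (b * c) ∈ J := by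
  have h1 : stepSum ρ μ m (b * c)
      = ∑ w, ∑ u, ρ (b w) * (ρ (c u) * μ (cyl m w)) * μ (cyl m u) := by
    refine Finset.sum_congr rfl fun w _ => ?_
    rw [Finset.sum_eq_single w]
    · rw [mul_assoc, mul_assoc, ← map_mul μ, cyl_mul_cyl, if_pos rfl, ← mul_assoc, ← map_mul]
      rfl
    · intro u _ hu
      rw [mul_assoc, mul_assoc, ← map_mul μ, cyl_mul_cyl, if_neg hu.symm, map_zero, mul_zero,
        mul_zero]
    · simp
  have h2 : stepSum ρ μ m b * stepSum ρ μ m c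
      = ∑ w, ∑ u, ρ (b w) * (μ (cyl m w) * ρ (c u)) * μ (cyl m u) := by
    simp only [stepSum, Finset.sum_mul_sum, mul_assoc]
  rw [h1, h2]
  simp only [← Finset.sum_sub_distrib]
  refine sum_mem fun w _ => sum_mem fun u _ => ?_
  rw [← sub_mul, ← mul_sub]
  refine J.mul_mem_right _ _ (J.mul_mem_left _ _ ?_)
  rw [← neg_sub]
  exact J.neg_mem (hJ _ _)

theorem star_stepSum_sub_mem (hJ : ∀ a f, ρ a * μ f - μ f * ρ a ∈ J) (m : ℕ) (b : (Fin m → Fin s) → toeplitzAlgebra) :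
    star (stepSum ρ μ m b) - stepSum ρ μ m (star b) ∈ J := by
  simp only [stepSum, star_sum, star_mul, ← map_star, star_cyl, Pi.star_apply,
    ← Finset.sum_sub_distrib]
  refine sum_mem fun w _ => ?_
  rw [← neg_sub]
  exact J.neg_mem (hJ _ _)

/-- The elements that are combinations of cylinder functions modulo an ideal. -/
def stepAlgebra [StarModule ℂ A] (hJ : ∀ a f, ρ a * μ f - μ f * ρ a ∈ J) (hstar : ∀ x ∈ J, star x ∈ J) :
    StarSubalgebra ℂ A where
  carrier := {x | ∃ m b, x - stepSum ρ μ m b ∈ J}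
  add_mem' := by
    rintro x y ⟨m, b, hx⟩ ⟨n, c, hy⟩
    rw [← stepSum_refine ρ μ (le_max_left m n)] at hx
    rw [← stepSum_refine ρ μ (le_max_right m n)] at hy
    have := J.add_mem hx hy
    rw [← add_sub_add_comm, ← stepSum_add] at this
    exact ⟨max m n, _, this⟩
  mul_mem' := by
    rintro x y ⟨m, b, hx⟩ ⟨n, c, hy⟩
    rw [← stepSum_refine ρ μ (le_max_left m n)] at hx
    rw [← stepSum_refine ρ μ (le_max_right m n)] at hy
    set b' : (Fin (max m n) → Fin s) → toeplitzAlgebra :=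
      fun u => b fun i => u (Fin.castLE (le_max_left m n) i)
    set c' : (Fin (max m n) → Fin s) → toeplitzAlgebra :=
      fun u => c fun i => u (Fin.castLE (le_max_right m n) i)
    -- With `B`, `C` the step sums of `b'`, `c'`: `xy - BC = (x - B) y + B (y - C)`, and `BC` agrees
    -- with the step sum of `b' * c'` modulo `J`.
    have := J.add_mem (J.add_mem (J.mul_mem_right _ y hx)
      (J.mul_mem_left (stepSum ρ μ (max m n) b') _ hy)) (stepSum_mul_sub_mem hJ _ b' c')
    rw [sub_mul, mul_sub, sub_add_sub_cancel, sub_add_sub_cancel] at this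
    exact ⟨max m n, _, this⟩
  algebraMap_mem' r := by
    -- At depth `0` the only cylinder is the whole space.
    refine ⟨0, fun _ => algebraMap ℂ _ r, ?_⟩
    rw [stepSum_const, AlgHomClass.commutes, sub_self]
    exact J.zero_mem
  star_mem' := by
    rintro x ⟨m, b, hx⟩
    refine ⟨m, star b, ?_⟩
    have := J.add_mem (hstar _ hx) (star_stepSum_sub_mem hJ m b)
    rwa [star_sub, sub_add_sub_cancel] at this

end Step

/-! ### Quotient maps defined by their graphs -/

section Graph

variable {A B : Type*} [CStarAlgebra A] [CStarAlgebra B]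

/-- A star subalgebra `Γ` of `A × B` on which the norm of the second component is the norm of the
first one modulo `K` is, up to closure, the graph of a quotient map. -/
theorem exists_quotient_of_graph (Γ : StarSubalgebra ℂ (A × B)) {K : Set A} (hK : IsClosed K)
    (h1 : ∀ x ∈ Γ, ‖x.2‖ ≤ ‖x.1‖)
    (h2 : ∀ x ∈ Γ, ∃ k ∈ K, (k, (0 : B)) ∈ Γ ∧ ‖x.1 - k‖ ≤ ‖x.2‖)
    (A₁ : StarSubalgebra ℂ A) (B₁ : StarSubalgebra ℂ B)
    (hA : A₁ = (Γ.map (StarAlgHom.fst ℂ A B)).topologicalClosure)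
    (hB : B₁ = (Γ.map (StarAlgHom.snd ℂ A B)).topologicalClosure) :
    ∃ q : A₁ →⋆ₐ[ℂ] B₁, Function.Surjective q ∧
      (∀ x ∈ Γ.topologicalClosure, ∀ h : x.1 ∈ A₁, (q ⟨x.1, h⟩ : B) = x.2) ∧
      ∀ a, q a = 0 → (a : A) ∈ K := by
  let Γc := Γ.topologicalClosure
  have hΓc : IsClosed (Γc : Set (A × B)) := Γ.isClosed_topologicalClosure
  have : CompleteSpace Γc := hΓc.completeSpace_coe
  have h1c : ∀ x ∈ Γc, ‖x.2‖ ≤ ‖x.1‖ := fun x hx =>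
    closure_minimal (t := {x : A × B | ‖x.2‖ ≤ ‖x.1‖}) h1
      (isClosed_le (by fun_prop) (by fun_prop)) hx
  have hfst : ∀ x : Γc, (x : A × B).1 ∈ A₁ := fun x => by
    rw [hA]
    exact map_mem_closure continuous_fst x.2 fun y hy => ⟨y, hy, rfl⟩
  have hsnd : ∀ x : Γc, (x : A × B).2 ∈ B₁ := fun x => by
    rw [hB]
    exact map_mem_closure continuous_snd x.2 fun y hy => ⟨y, hy, rfl⟩
  let f : Γc →⋆ₐ[ℂ] A := (StarAlgHom.fst ℂ A B).comp Γc.subtype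
  let g : Γc →⋆ₐ[ℂ] B := (StarAlgHom.snd ℂ A B).comp Γc.subtype
  -- The norm of `A × B` is the maximum, attained by the first component. So `f` has closed range,
  -- namely `A₁`, and can be inverted.
  have hf : Isometry f := AddMonoidHomClass.isometry_of_norm f fun x =>
    (max_eq_left (h1c x x.2)).symm
  have hrange : ∀ a ∈ A₁, ∃ x : Γc, f x = a := fun a ha => by
    have hcl : IsClosed (Set.range f) := hf.isClosedEmbedding.isClosed_range
    rw [hA] at ha
    refine closure_minimal ?_ hcl ha
    rintro _ ⟨y, hy, rfl⟩
    exact ⟨⟨y, Γ.le_topologicalClosure hy⟩, rfl⟩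
  let f₁ : Γc →⋆ₐ[ℂ] A₁ := f.codRestrict A₁ hfst
  let g₁ : Γc →⋆ₐ[ℂ] B₁ := g.codRestrict B₁ hsnd
  have hbij : Function.Bijective f₁ :=
    ⟨fun x y h => hf.injective (congrArg Subtype.val h), fun a => by
      obtain ⟨x, hx⟩ := hrange a a.2
      exact ⟨x, Subtype.ext hx⟩⟩
  let e := StarAlgEquiv.ofBijective f₁ hbij
  let q : A₁ →⋆ₐ[ℂ] B₁ := g₁.comp (e.symm : A₁ →⋆ₐ[ℂ] Γc)
  have hq : ∀ x : Γc, q (f₁ x) = g₁ x := fun x => congrArg g₁ (e.symm_apply_apply x)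
  refine ⟨q, fun b => ?_, fun x hx h => congrArg Subtype.val (hq ⟨x, hx⟩), fun a ha => ?_⟩
  · let gn : NormedAddGroupHom Γc B :=
      { toFun := g
        map_add' := map_add g
        bound' := ⟨1, fun x => by
          rw [one_mul]
          exact le_max_right ‖(x : A × B).1‖ ‖(x : A × B).2‖⟩ }
    let D : AddSubgroup B := (Γ.map (StarAlgHom.snd ℂ A B)).toSubalgebra.toSubmodule.toAddSubgroup
    -- Subtracting `(k, 0)` from a lift makes its norm at most that of its image. This uniform
    -- control is what lets surjectivity pass to the closure `B₁`.
    have hD : gn.SurjectiveOnWith D 1 := by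
      rintro _ ⟨x, hx, rfl⟩
      obtain ⟨k, -, hkΓ, hk⟩ := h2 x hx
      refine ⟨⟨x - (k, 0), Γ.le_topologicalClosure (sub_mem hx hkΓ)⟩, ?_, ?_⟩
      · change x.2 - 0 = x.2
        rw [sub_zero]
      · rw [one_mul]
        change max ‖x.1 - k‖ ‖x.2 - 0‖ ≤ ‖x.2‖
        rw [sub_zero]
        exact max_le hk le_rfl
    have hb : (b : B) ∈ D.topologicalClosure := hB.le b.2
    obtain ⟨x, hx, -⟩ := controlled_closure_of_complete one_pos one_pos hD b hb
    exact ⟨f₁ x, (hq x).trans (Subtype.ext hx)⟩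
  · obtain ⟨x, rfl⟩ := hbij.2 a
    rw [hq] at ha
    have hx2 : (x : A × B).2 = 0 := congrArg Subtype.val ha
    rw [← hK.closure_eq, Metric.mem_closure_iff]
    intro ε hε
    -- For `y` in `Γ` near `x` the second component is small, so `h2` puts `y.1`, and with it `x.1`,
    -- close to `K`.
    obtain ⟨y, hy, hxy⟩ := Metric.mem_closure_iff.1 x.2 (ε / 2) (by positivity)
    rw [dist_eq_norm] at hxy
    have e1 : ‖(x : A × B).1 - y.1‖ < ε / 2 := (le_max_left _ _).trans_lt hxy
    have e2 : ‖(x : A × B).2 - y.2‖ < ε / 2 := (le_max_right _ _).trans_lt hxy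
    rw [hx2, zero_sub, norm_neg] at e2
    obtain ⟨k, hk, -, hyk⟩ := h2 y hy
    refine ⟨k, hk, ?_⟩
    change dist (x : A × B).1 k < ε
    rw [dist_eq_norm]
    have := norm_sub_le_norm_sub_add_norm_sub (x : A × B).1 y.1 k
    linarith

/-- The ideal `K × 0` of a product. -/
def idealProdBot {A : Type*} [Ring A] (K : TwoSidedIdeal A) (B : Type*) [Ring B] :
    TwoSidedIdeal (A × B) :=
  TwoSidedIdeal.mk' {x | x.1 ∈ K ∧ x.2 = 0} ⟨K.zero_mem, rfl⟩
    (fun ha hb => ⟨K.add_mem ha.1 hb.1, by rw [Prod.snd_add, ha.2, hb.2, add_zero]⟩)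
    (fun ha => ⟨K.neg_mem ha.1, by rw [Prod.snd_neg, ha.2, neg_zero]⟩)
    (fun hb => ⟨K.mul_mem_left _ _ hb.1, by rw [Prod.snd_mul, hb.2, mul_zero]⟩)
    (fun ha => ⟨K.mul_mem_right _ _ ha.1, by rw [Prod.snd_mul, ha.2, zero_mul]⟩)

theorem mem_idealProdBot {A : Type*} [Ring A] {K : TwoSidedIdeal A} {B : Type*} [Ring B]
    {x : A × B} : x ∈ idealProdBot K B ↔ x.1 ∈ K ∧ x.2 = 0 :=
  TwoSidedIdeal.mem_mk' ..

end Graph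

theorem stepSum_prod {s : ℕ} {A B : Type*} [Ring A] [StarRing A] [Algebra ℂ A] [Ring B]
    [StarRing B] [Algebra ℂ B] (ρ : toeplitzAlgebra →⋆ₐ[ℂ] A) (μ : C(SAdicInt s, ℂ) →⋆ₐ[ℂ] A)
    (ρ' : toeplitzAlgebra →⋆ₐ[ℂ] B) (μ' : C(SAdicInt s, ℂ) →⋆ₐ[ℂ] B) (m : ℕ)
    (b : (Fin m → Fin s) → toeplitzAlgebra) :
    stepSum (ρ.prod ρ') (μ.prod μ') m b = (stepSum ρ μ m b, stepSum ρ' μ' m b) := by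
  refine Prod.ext ?_ ?_
  · unfold stepSum
    rw [Prod.fst_sum]
    rfl
  · unfold stepSum
    rw [Prod.snd_sum]
    rfl

/-! ### Norms of combinations of cylinder functions -/

section Norm

variable {s : ℕ} [NeZero s]

theorem norm_cyl_le {s : ℕ} (m : ℕ) (w : Fin m → Fin s) : ‖cyl m w‖ ≤ 1 := by
  refine (ContinuousMap.norm_le _ zero_le_one).2 fun x => ?_
  rw [cyl_apply]
  split_ifs <;> simp

theorem cyl_ne_zero (m : ℕ) (w : Fin m → Fin s) : cyl m w ≠ 0 := by
  obtain ⟨x, hx⟩ := exists_digits_eq m w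
  intro h
  have := congrArg (fun f => f x) h
  simp [cyl_apply, hx] at this

/-- Block diagonal combinations of cylinder functions are bounded by their coefficients. -/
theorem norm_sum_cyl_block_le {s : ℕ} {G : Type*} [NormedAddCommGroup G] [InnerProductSpace ℂ G]
    [CompleteSpace G] (ρ : toeplitzAlgebra →⋆ₐ[ℂ] Op G) (μ : C(SAdicInt s, ℂ) →⋆ₐ[ℂ] Op G)
    (m : ℕ) (b : (Fin m → Fin s) → toeplitzAlgebra) {C : ℝ} (hC : 0 ≤ C)
    (hb : ∀ w, ‖b w‖ ≤ C) :
    ‖∑ w, μ (cyl m w) * ρ (b w) * μ (cyl m w)‖ ≤ C := by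
  refine norm_sum_block_le (p := fun w => μ (cyl m w)) (fun w => ?_) (fun w u => ?_) ?_
    (fun w => ρ (b w)) hC fun w => (NonUnitalStarAlgHom.norm_apply_le ρ (b w)).trans (hb w)
  · rw [← map_star, star_cyl]
  · rw [← map_mul, cyl_mul_cyl]
    split_ifs
    · rfl
    · exact map_zero μ
  · rw [← map_sum, sum_cyl, map_one]

section Tensor

variable {E F : Type*} [NormedAddCommGroup E] [InnerProductSpace ℂ E] [CompleteSpace E]
  [NormedAddCommGroup F] [InnerProductSpace ℂ F] [CompleteSpace F]
  (π : toeplitzAlgebra →⋆ₐ[ℂ] Op E) (σ : C(SAdicInt s, ℂ) →⋆ₐ[ℂ] Op F)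

theorem stepSum_tensor {s : ℕ} (σ : C(SAdicInt s, ℂ) →⋆ₐ[ℂ] Op F) (m : ℕ)
    (b : (Fin m → Fin s) → toeplitzAlgebra) :
    stepSum ((leftTensor E F).comp π) ((rightTensor E F).comp σ) m b
      = ∑ w, opTensor (π (b w)) (σ (cyl m w)) :=
  Finset.sum_congr rfl fun _ _ => leftTensor_mul_rightTensor _ _

/-- Here the two factors commute exactly, so the step sum is already block diagonal. -/
theorem norm_stepSum_tensor_le {s : ℕ} (σ : C(SAdicInt s, ℂ) →⋆ₐ[ℂ] Op F) (m : ℕ)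
    (b : (Fin m → Fin s) → toeplitzAlgebra) {C : ℝ} (hC : 0 ≤ C) (hb : ∀ w, ‖b w‖ ≤ C) :
    ‖stepSum ((leftTensor E F).comp π) ((rightTensor E F).comp σ) m b‖ ≤ C := by
  have h := norm_sum_cyl_block_le ((leftTensor E F).comp π) ((rightTensor E F).comp σ) m b hC hb
  convert h using 2
  rw [stepSum_tensor]
  refine Finset.sum_congr rfl fun w _ => ?_
  simp only [StarAlgHom.comp_apply]
  rw [rightTensor_mul_leftTensor, ← leftTensor_mul_rightTensor, mul_assoc, ← map_mul, ← map_mul,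
    cyl_mul_cyl, if_pos rfl]

variable {π σ} in
-- Multiplying by the contraction `1 ⊗ σ (cyl m w)` isolates one term. Injectivity makes `π`
-- isometric and `σ (cyl m w)` nonzero.
theorem norm_le_norm_stepSum_tensor (hπ : Function.Injective π) (hσ : Function.Injective σ)
    (m : ℕ) (b : (Fin m → Fin s) → toeplitzAlgebra) (w : Fin m → Fin s) :
    ‖b w‖ ≤ ‖stepSum ((leftTensor E F).comp π) ((rightTensor E F).comp σ) m b‖ := by
  set X := stepSum ((leftTensor E F).comp π) ((rightTensor E F).comp σ) m b with hX
  have h1 : X * rightTensor E F (σ (cyl m w)) = opTensor (π (b w)) (σ (cyl m w)) := by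
    rw [hX, stepSum, Finset.sum_mul, Finset.sum_eq_single w]
    · simp only [StarAlgHom.comp_apply]
      rw [mul_assoc, ← map_mul, ← map_mul, cyl_mul_cyl, if_pos rfl, leftTensor_mul_rightTensor]
    · intro u _ hu
      simp only [StarAlgHom.comp_apply]
      rw [mul_assoc, ← map_mul, ← map_mul, cyl_mul_cyl, if_neg hu, map_zero, map_zero, mul_zero]
    · simp
  have h2 : ‖rightTensor E F (σ (cyl m w))‖ ≤ 1 :=
    (NonUnitalStarAlgHom.norm_apply_le (rightTensor E F) _).trans
      ((NonUnitalStarAlgHom.norm_apply_le σ _).trans (norm_cyl_le m w))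
  have h3 : σ (cyl m w) * σ (cyl m w) = σ (cyl m w) := by
    rw [← map_mul, cyl_mul_cyl, if_pos rfl]
  have h4 : σ (cyl m w) ≠ 0 := fun h => cyl_ne_zero m w (hσ (h.trans (map_zero σ).symm))
  calc ‖b w‖ = ‖π (b w)‖ := (NonUnitalStarAlgHom.norm_map π hπ (b w)).symm
    _ ≤ ‖opTensor (π (b w)) (σ (cyl m w))‖ := norm_le_norm_opTensor_idempotent _ h3 h4
    _ = ‖X * rightTensor E F (σ (cyl m w))‖ := by rw [h1]
    _ ≤ ‖X‖ * ‖rightTensor E F (σ (cyl m w))‖ := norm_mul_le _ _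
    _ ≤ ‖X‖ * 1 := by gcongr
    _ = ‖X‖ := mul_one _

end Tensor

section Serre

variable (ρ : toeplitzAlgebra →⋆ₐ[ℂ] Op (L2 (Vertex s)))

/-- The block diagonal sum `D` differs from the step sum only by commutators, which are compact, and
its norm is controlled by its blocks. -/
theorem exists_compact_norm_sub_le (hρ : ρ genS = serreShift s) {m : ℕ}
    {b : (Fin m → Fin s) → toeplitzAlgebra} {T : Op (L2 (Vertex s))}
    (hT : T - stepSum ρ (multHom s) m b ∈ compactIdeal (Vertex s)) {C : ℝ} (hC : 0 ≤ C)
    (hb : ∀ w, ‖b w‖ ≤ C) : ∃ k ∈ compactIdeal (Vertex s), ‖T - k‖ ≤ C := by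
  set D := ∑ w, multHom s (cyl m w) * ρ (b w) * multHom s (cyl m w)
  have h1 : stepSum ρ (multHom s) m b - D ∈ compactIdeal (Vertex s) := by
    have : stepSum ρ (multHom s) m b - D = ∑ w, (ρ (b w) * multHom s (cyl m w)
        - multHom s (cyl m w) * ρ (b w)) * multHom s (cyl m w) := by
      simp only [stepSum, D, ← Finset.sum_sub_distrib]
      refine Finset.sum_congr rfl fun w _ => ?_
      rw [sub_mul, mul_assoc (ρ (b w)), ← map_mul, cyl_mul_cyl, if_pos rfl]
    rw [this]
    exact sum_mem fun w _ => (compactIdeal _).mul_mem_right _ _ (commutator_rep_mult ρ hρ _ _)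
  refine ⟨T - D, ?_, ?_⟩
  · have := (compactIdeal _).add_mem hT h1
    rwa [sub_add_sub_cancel] at this
  · rw [sub_sub_cancel]
    exact norm_sum_cyl_block_le ρ (multHom s) m b hC hb

/-- Compress `T` to the copy of `ℓ²(ℕ)` generated by a wandering vector in the ball of `w`. The step
sum acts there as `b w`, and for a deep enough vector the compact part contributes less than `ε`. -/
theorem norm_coeff_le (hs : 2 ≤ s) (hρ : ρ genS = serreShift s) {m : ℕ}
    {b : (Fin m → Fin s) → toeplitzAlgebra} {T : Op (L2 (Vertex s))}
    (hT : T - stepSum ρ (multHom s) m b ∈ compactIdeal (Vertex s)) (w : Fin m → Fin s) :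
    ‖b w‖ ≤ ‖T‖ := by
  refine le_of_forall_pos_le_add fun ε hε => ?_
  set k := T - stepSum ρ (multHom s) m b with hk
  obtain ⟨t, ht⟩ := exists_finProj_mul_sub_lt (mem_compactIdeal.1 hT) hε
  -- One level beyond every vertex of `t`, so that the range of `V` is orthogonal to that of
  -- `finProj t`.
  obtain ⟨v, hv1, hv0, hv⟩ := exists_wandering_vector hs m w (t.sup (fun u => u.1) + 1)
  set V := wanderingEmb star_serreShift_mul_self hv0 hv1 with hVdef
  have hsupp : ∀ (x : L2 ℕ) (u : Vertex s), ¬ (t.sup (fun u => u.1) + 1 ≤ u.1 ∧ m ≤ u.1 ∧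
      digits m (ofNat s u.2) = w) → V x u = 0 :=
    wanderingEmb_apply_eq_zero (fun u j hu => ⟨hu.1.trans (Nat.le_succ _),
      hu.2.1.trans (Nat.le_succ _), by rw [digits_child u j hu.2.1, hu.2.2]⟩) hv hv0 hv1
  have hcyl : ∀ u x, multHom s (cyl m u) (V x) = if u = w then V x else 0 := fun u x => by
    refine lp.ext (funext fun i => ?_)
    rw [multHom_apply, multOp_apply, cyl_apply]
    by_cases hi : V x i = 0
    · rw [hi, mul_zero]
      split_ifs
      · exact hi.symm
      · rfl
    · have hd : digits m (ofNat s i.2) = w := by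
        by_contra h
        exact hi (hsupp x i fun h' => h h'.2.2)
      rw [hd]
      by_cases hu : u = w
      · simp [hu]
      · simp [hu, Ne.symm hu]
  have hstep : ∀ x, stepSum ρ (multHom s) m b (V x) = V ((b w : Op (L2 ℕ)) x) := fun x => by
    rw [stepSum, sum_apply, Finset.sum_eq_single w]
    · rw [mul_apply_eq_comp, hcyl, if_pos rfl]
      exact (congrArg (fun S => S x)
        (wanderingEmb_intertwines star_serreShift_mul_self hv0 hv1 ρ hρ (b w))).symm
    · intro u _ hu
      rw [mul_apply_eq_comp, hcyl, if_neg hu, map_zero]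
    · simp
  have horth : ∀ x y, ⟪V x, finProj t y⟫_ℂ = 0 := fun x y => by
    rw [finProj_apply, inner_sum]
    refine Finset.sum_eq_zero fun i hi => ?_
    rw [inner_smul_right, ← inner_conj_symm, inner_basisVec_left, hsupp x i, map_zero, mul_zero]
    have := Finset.le_sup (f := fun u : Vertex s => u.1) hi
    intro h
    have := h.1
    omega
  refine ContinuousLinearMap.opNorm_le_bound _ (by positivity) fun x => ?_
  set y := (b w : Op (L2 ℕ)) x with hy
  change ‖y‖ ≤ (‖T‖ + ε) * ‖x‖
  have hdec : V y = T (V x) - (k - finProj t * k) (V x) - finProj t (k (V x)) := by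
    rw [hy, ← hstep x]
    simp only [hk, sub_apply, mul_apply_eq_comp]
    abel
  -- Pairing with `V y` removes the finite-rank part of `k`; the rest of `k` has norm below `ε`.
  have hin : ⟪V y, V y⟫_ℂ = ⟪V y, T (V x) - (k - finProj t * k) (V x)⟫_ℂ := by
    conv_lhs => rw [show ⟪V y, V y⟫_ℂ = ⟪V y, T (V x) - (k - finProj t * k) (V x)
      - finProj t (k (V x))⟫_ℂ by rw [← hdec]]
    rw [inner_sub_right, horth, sub_zero]
  have hn : ‖T (V x) - (k - finProj t * k) (V x)‖ ≤ (‖T‖ + ε) * ‖x‖ := by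
    refine (norm_sub_le _ _).trans ?_
    have e1 := T.le_opNorm (V x)
    have e2 := (k - finProj t * k).le_of_opNorm_le ht.le (V x)
    rw [V.norm_map] at e1 e2
    linarith
  have h3 : ‖y‖ * ‖y‖ ≤ ‖y‖ * ((‖T‖ + ε) * ‖x‖) := by
    have e1 := norm_inner_le_norm (𝕜 := ℂ) (V y) (T (V x) - (k - finProj t * k) (V x))
    rw [← hin, inner_self_eq_norm_sq_to_K, V.norm_map, norm_pow, RCLike.norm_ofReal,
      abs_of_nonneg (norm_nonneg _), sq] at e1
    exact e1.trans (by gcongr)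
  rcases (norm_nonneg y).eq_or_lt with h0 | h0
  · rw [← h0]
    positivity
  · exact le_of_mul_le_mul_left h3 h0

end Serre

end Norm

/-! ### The exact sequence -/

section Exact

variable {s : ℕ} [NeZero s] {E F : Type*} [NormedAddCommGroup E] [InnerProductSpace ℂ E]
  [CompleteSpace E] [NormedAddCommGroup F] [InnerProductSpace ℂ F] [CompleteSpace F]

theorem rep_mem_serreAlgebra {ρ : toeplitzAlgebra →⋆ₐ[ℂ] Op (L2 (Vertex s))}
    (hρ : ρ genS = serreShift s) (a : toeplitzAlgebra) : ρ a ∈ serreAlgebra s := by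
  refine toeplitz_induction (P := fun a => ρ a ∈ serreAlgebra s) ?_ ?_ ?_ ?_ ?_ ?_ a
  · rw [hρ]
    exact serreShift_mem
  · rw [map_star, hρ]
    exact star_mem serreShift_mem
  · intro r
    rw [AlgHomClass.commutes]
    exact algebraMap_mem _ r
  · intro u v hu hv
    rw [map_add]
    exact add_mem hu hv
  · intro u v hu hv
    rw [map_mul]
    exact mul_mem hu hv
  · exact isClosed_serreAlgebra.preimage (continuous_starAlgHom ρ)

/-- The pairs of an operator on `ℓ²` of the tree and an operator on the tensor product that are
given, modulo compact operators in the first component, by the same combination of cylinder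
functions with coefficients in the Toeplitz algebra. -/
def symbolGraph (ρ : toeplitzAlgebra →⋆ₐ[ℂ] Op (L2 (Vertex s))) (hρ : ρ genS = serreShift s)
    (π : toeplitzAlgebra →⋆ₐ[ℂ] Op E) (σ : C(SAdicInt s, ℂ) →⋆ₐ[ℂ] Op F) :
    StarSubalgebra ℂ (Op (L2 (Vertex s)) × Op (HilbertTensor E F)) :=
  stepAlgebra (ρ := ρ.prod ((leftTensor E F).comp π))
    (μ := (multHom s).prod ((rightTensor E F).comp σ))
    (J := idealProdBot (compactIdeal (Vertex s)) (Op (HilbertTensor E F)))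
    (fun a f => mem_idealProdBot.2 ⟨commutator_rep_mult ρ hρ a f, by
      change leftTensor E F (π a) * rightTensor E F (σ f)
        - rightTensor E F (σ f) * leftTensor E F (π a) = 0
      rw [leftTensor_mul_rightTensor, rightTensor_mul_leftTensor, sub_self]⟩)
    (fun x hx => mem_idealProdBot.2 ⟨star_mem_compactIdeal (mem_idealProdBot.1 hx).1, by
      rw [Prod.snd_star, (mem_idealProdBot.1 hx).2, star_zero]⟩)

variable {ρ : toeplitzAlgebra →⋆ₐ[ℂ] Op (L2 (Vertex s))} (hρ : ρ genS = serreShift s)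
  (π : toeplitzAlgebra →⋆ₐ[ℂ] Op E) (σ : C(SAdicInt s, ℂ) →⋆ₐ[ℂ] Op F)

theorem mem_symbolGraph {x : Op (L2 (Vertex s)) × Op (HilbertTensor E F)} :
    x ∈ symbolGraph ρ hρ π σ ↔ ∃ m b,
      x.1 - stepSum ρ (multHom s) m b ∈ compactIdeal (Vertex s) ∧
      x.2 = stepSum ((leftTensor E F).comp π) ((rightTensor E F).comp σ) m b := by
  refine exists_congr fun m => exists_congr fun b => ?_
  rw [mem_idealProdBot, stepSum_prod, Prod.fst_sub, Prod.snd_sub, sub_eq_zero]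

theorem rep_mem_symbolGraph (a : toeplitzAlgebra) :
    (ρ a, leftTensor E F (π a)) ∈ symbolGraph ρ hρ π σ := by
  refine (mem_symbolGraph hρ π σ).2 ⟨0, fun _ => a, ?_, ?_⟩
  · rw [stepSum_const, sub_self]
    exact (compactIdeal _).zero_mem
  · rw [stepSum_const]
    rfl

theorem compact_mem_symbolGraph {k : Op (L2 (Vertex s))} (hk : k ∈ compactIdeal (Vertex s)) :
    (k, (0 : Op (HilbertTensor E F))) ∈ symbolGraph ρ hρ π σ := by
  refine (mem_symbolGraph hρ π σ).2 ⟨0, fun _ => 0, ?_, ?_⟩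
  · rwa [stepSum_const, map_zero, sub_zero]
  · rw [stepSum_const, map_zero]

theorem step_mem_symbolGraph (m : ℕ) (c : (Fin m → Fin s) → ℂ) :
    (multHom s (∑ w, c w • cyl m w), rightTensor E F (σ (∑ w, c w • cyl m w)))
      ∈ symbolGraph ρ hρ π σ := by
  refine (mem_symbolGraph hρ π σ).2 ⟨m, fun w => algebraMap ℂ _ (c w), ?_, ?_⟩
  · simp only [stepSum, AlgHomClass.commutes, ← Algebra.smul_def, map_sum, map_smul, sub_self]
    exact (compactIdeal _).zero_mem
  · simp only [stepSum, AlgHomClass.commutes, ← Algebra.smul_def, map_sum, map_smul,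
      StarAlgHom.comp_apply]

/-- Step functions give elements of the graph itself; a general `f` is a uniform limit of them. -/
theorem mult_mem_closure_symbolGraph (f : C(SAdicInt s, ℂ)) :
    (multHom s f, rightTensor E F (σ f)) ∈ (symbolGraph ρ hρ π σ).topologicalClosure := by
  have hc : Continuous fun f : C(SAdicInt s, ℂ) => (multHom s f, rightTensor E F (σ f)) :=
    (continuous_starAlgHom (multHom s)).prodMk
      ((continuous_starAlgHom (rightTensor E F)).comp (continuous_starAlgHom σ))
  have hf : f ∈ closure {g : C(SAdicInt s, ℂ) | ∃ (m : ℕ) (c : (Fin m → Fin s) → ℂ),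
      g = ∑ w, c w • cyl m w} := by
    refine Metric.mem_closure_iff.2 fun ε hε => ?_
    obtain ⟨m, c, h⟩ := exists_step_approx f (half_pos hε)
    exact ⟨_, ⟨m, c, rfl⟩, by rw [dist_eq_norm]; linarith⟩
  refine map_mem_closure (f := fun f : C(SAdicInt s, ℂ) => (multHom s f, rightTensor E F (σ f)))
    hc hf ?_
  rintro _ ⟨m, c, rfl⟩
  exact step_mem_symbolGraph hρ π σ m c

/-- The inclusion of the closure in `A_W` relies on the compacts lying in `A_W`, since graph
elements have arbitrary compact parts. -/
theorem serreAlgebra_eq_closure (hs : 2 ≤ s) :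
    serreAlgebra s = ((symbolGraph ρ hρ π σ).map
      (StarAlgHom.fst ℂ (Op (L2 (Vertex s))) (Op (HilbertTensor E F)))).topologicalClosure := by
  apply le_antisymm
  · refine StarSubalgebra.topologicalClosure_minimal (StarAlgebra.adjoin_le ?_)
      (StarSubalgebra.isClosed_topologicalClosure _)
    rintro _ (rfl | ⟨f, rfl⟩)
    · rw [← hρ]
      exact StarSubalgebra.le_topologicalClosure _
        ⟨_, rep_mem_symbolGraph hρ π σ genS, rfl⟩
    · exact map_mem_closure (f := Prod.fst) continuous_fst (mult_mem_closure_symbolGraph hρ π σ f)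
        fun y hy => ⟨y, hy, rfl⟩
  · refine StarSubalgebra.topologicalClosure_minimal ?_ isClosed_serreAlgebra
    rintro _ ⟨x, hx, rfl⟩
    obtain ⟨m, b, hk, -⟩ := (mem_symbolGraph hρ π σ).1 hx
    have h1 : stepSum ρ (multHom s) m b ∈ serreAlgebra s :=
      sum_mem fun w _ => mul_mem (rep_mem_serreAlgebra hρ _) (multOp_mem _)
    have h2 := add_mem (compact_mem_serreAlgebra hs (mem_compactIdeal.1 hk)) h1
    rwa [sub_add_cancel] at h2

theorem spatialTensor_eq_closure :
    spatialTensor π σ = ((symbolGraph ρ hρ π σ).map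
      (StarAlgHom.snd ℂ (Op (L2 (Vertex s))) (Op (HilbertTensor E F)))).topologicalClosure := by
  apply le_antisymm
  · refine StarSubalgebra.topologicalClosure_minimal (StarAlgebra.adjoin_le ?_)
      (StarSubalgebra.isClosed_topologicalClosure _)
    rintro _ ⟨a, f, rfl⟩
    rw [← leftTensor_mul_rightTensor]
    refine mul_mem (StarSubalgebra.le_topologicalClosure _
      ⟨_, rep_mem_symbolGraph hρ π σ a, rfl⟩) ?_
    exact map_mem_closure (f := Prod.snd) continuous_snd (mult_mem_closure_symbolGraph hρ π σ f)
      fun y hy => ⟨y, hy, rfl⟩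
  · refine StarSubalgebra.topologicalClosure_minimal ?_
      (StarSubalgebra.isClosed_topologicalClosure _)
    rintro _ ⟨x, hx, rfl⟩
    obtain ⟨m, b, -, h⟩ := (mem_symbolGraph hρ π σ).1 hx
    change x.2 ∈ spatialTensor π σ
    rw [h, stepSum_tensor]
    exact sum_mem fun w _ => (elemTensor π σ (b w) (cyl m w)).2

variable {π σ} in
-- Both norm conditions on the graph are read off the coefficients: `‖x.2‖ ≤ max ‖b w‖ ≤ ‖x.1‖`, and
-- the distance from `x.1` to some compact is at most `max ‖b w‖ ≤ ‖x.2‖`.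
theorem exists_symbol_map (hs : 2 ≤ s) (hπ : Function.Injective π) (hσ : Function.Injective σ) :
    ∃ q : serreAlgebra s →⋆ₐ[ℂ] spatialTensor π σ, Function.Surjective q ∧
      (∀ a, q a = 0 ↔ IsCompactOperator (a : Op (L2 (Vertex s)))) ∧
      q (genW s) = elemTensor π σ genS 1 ∧ ∀ f, q (genM f) = elemTensor π σ 1 f := by
  obtain ⟨ρ, hρ⟩ := exists_serre_rep s
  obtain ⟨q, hq, hgraph, hker⟩ := exists_quotient_of_graph (symbolGraph ρ hρ π σ)
    (isClosed_compactIdeal (Vertex s))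
    (fun x hx => by
      obtain ⟨m, b, hk, h⟩ := (mem_symbolGraph hρ π σ).1 hx
      rw [h]
      exact norm_stepSum_tensor_le π σ m b (norm_nonneg _) (norm_coeff_le ρ hs hρ hk))
    (fun x hx => by
      obtain ⟨m, b, hk, h⟩ := (mem_symbolGraph hρ π σ).1 hx
      obtain ⟨k, hk', hle⟩ := exists_compact_norm_sub_le ρ hρ hk (norm_nonneg x.2) fun w => by
        rw [h]
        exact norm_le_norm_stepSum_tensor hπ hσ m b w
      exact ⟨k, hk', compact_mem_symbolGraph hρ π σ hk', hle⟩)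
    (serreAlgebra s) (spatialTensor π σ) (serreAlgebra_eq_closure hρ π σ hs)
    (spatialTensor_eq_closure hρ π σ)
  refine ⟨q, hq, fun a => ⟨fun h => mem_compactIdeal.1 (hker a h), fun h => ?_⟩, ?_, fun f => ?_⟩
  · exact Subtype.ext (hgraph (a, 0) (StarSubalgebra.le_topologicalClosure _
      (compact_mem_symbolGraph hρ π σ (mem_compactIdeal.2 h))) a.2)
  · have h := StarSubalgebra.le_topologicalClosure _ (rep_mem_symbolGraph hρ π σ genS)
    rw [hρ] at h
    refine Subtype.ext ((hgraph _ h serreShift_mem).trans ?_)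
    change opTensor (π genS) 1 = opTensor (π genS) (σ 1)
    rw [map_one σ]
  · refine Subtype.ext ((hgraph _ (mult_mem_closure_symbolGraph hρ π σ f) (multOp_mem f)).trans ?_)
    change opTensor 1 (σ f) = opTensor (π 1) (σ f)
    rw [map_one π]

/-- The inclusion of the ideal `𝓘_W`, which consists of the compact operators, in `A_W`. -/
def serreIdealInclusion (hs : 2 ≤ s) : serreIdeal s →⋆ₙₐ[ℂ] serreAlgebra s where
  toFun k := ⟨k, compact_mem_serreAlgebra hs ((mem_serreIdeal_iff _).1 k.2)⟩
  map_smul' _ _ := rfl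
  map_zero' := rfl
  map_add' _ _ := rfl
  map_mul' _ _ := rfl
  map_star' _ := rfl

end Exact

end SerreShift

end

theorem theorem7p3 (s : ℕ) [NeZero s] (hs : 2 ≤ s)
    {E : Type*} [NormedAddCommGroup E] [InnerProductSpace ℂ E] [CompleteSpace E]
    (π : SerreShift.toeplitzAlgebra →⋆ₐ[ℂ] SerreShift.Op E) (hπ : Function.Injective π)
    {F : Type*} [NormedAddCommGroup F] [InnerProductSpace ℂ F] [CompleteSpace F]
    (σ : C(SerreShift.SAdicInt s, ℂ) →⋆ₐ[ℂ] SerreShift.Op F) (hσ : Function.Injective σ) :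
    (∀ k : SerreShift.Op (SerreShift.L2 (SerreShift.Vertex s)),
      k ∈ SerreShift.serreIdeal s ↔ IsCompactOperator k) ∧
    ∃ (ι : SerreShift.serreIdeal s →⋆ₙₐ[ℂ] SerreShift.serreAlgebra s)
      (q : SerreShift.serreAlgebra s →⋆ₐ[ℂ] SerreShift.spatialTensor π σ),
      (∀ k, (ι k : SerreShift.Op (SerreShift.L2 (SerreShift.Vertex s))) = k) ∧
      Function.Injective ι ∧
      Function.Exact ι q ∧
      Function.Surjective q ∧
      q (SerreShift.genW s) = SerreShift.elemTensor π σ SerreShift.genS 1 ∧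
      ∀ f : C(SerreShift.SAdicInt s, ℂ),
        q (SerreShift.genM f) = SerreShift.elemTensor π σ 1 f := by
  obtain ⟨q, hsurj, hker, hW, hM⟩ := SerreShift.exists_symbol_map hs hπ hσ
  refine ⟨SerreShift.mem_serreIdeal_iff, SerreShift.serreIdealInclusion hs, q, fun _ => rfl,
    fun x y h => Subtype.ext (congrArg (fun a : SerreShift.serreAlgebra s =>
      (a : SerreShift.Op (SerreShift.L2 (SerreShift.Vertex s)))) h), fun a => (hker a).trans ?_, hsurj, hW, hM⟩
  constructor
  · intro h
    exact ⟨⟨a, (SerreShift.mem_serreIdeal_iff _).2 h⟩, rfl⟩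
  · rintro ⟨k, rfl⟩
    exact (SerreShift.mem_serreIdeal_iff _).1 k.2
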